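/- Consider a two-player game given by $n\times m$ payoff matrices $A$ (row player) and $B$ (column player) with integer entries, $n,m\ge 1$. A subgame is a pair $(I,J)$ with $I\subseteq\{1,\dots,n\}$, $J\subseteq\{1,\dots,m\}$. In a subgame $(I,J)$, a row $i\in I$ is *weakly dominated* if there is $i_0\in I$, $i_0\neq i$, with $A_{i_0,j}\ge A_{i,j}$ for all $j\in J$; it is *dominated* if there is $i_0\in I$ with $A_{i_0,j}\ge A_{i,j}$ for all $j\in J$ and $A_{i_0,j_0}>A_{i,j_0}$ for some $j_0\in J$. Symmetrically, a column $j\in J$ is weakly dominated if there is $j_0\in J$, $j_0\ne j$, with $B_{i,j_0}\ge B_{i,j}$ for all $i\in I$, and dominated if there is $j_0\in J$ with $B_{i,j_0}\ge B_{i,j}$ for all $i\in I$ and $B_{i_0,j_0}>B_{i_0,j}$ for some $i_0\in I$. Consider three kinds of elimination steps on subgames: - a *Weak* step removes one weakly dominated row or column; - a *Dominance* step removes one dominated row or column; - a *Simultaneous* step replaces $(I,J)$ by $(I\setminus K,J\setminus L)$, where $K\subseteq I$, $L\subseteq J$ are maximal such that all rows in $K$ and all columns in $L$ are dominated in $(I,J)$.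 For each kind $E\in\{\textsc{Weak},\textsc{Dominance},\textsc{Simultaneous}\}$, the problem $3\textsc{-Z-}E$ has as instances all zero-sum games ($B=-A$) in which at most three different values occur among the entries of $A$ and $B$ together, with a designated row $i$ (integers written in binary, the matrices listed row by row); the question is whether some finite sequence of $E$-steps leads from $(\{1,\dots,n\},\{1,\dots,m\})$ to a subgame $(I,J)$ with $i\notin I$. **Theorem.** The problems $3\textsc{-Z-Weak}$, $3\textsc{-Z-Dominance}$ and $3\textsc{-Z-Simultaneous}$ are $P$-hard: for each of them and for every language $L\subseteq\{0,1\}^*$ decidable by a deterministic Turing machine in polynomial time, there is a map $f$, computable by a deterministic Turing machine in logarithmic space, from $\{0,1\}^*$ to (encoded) instances of the problem such that, for all $x\in\{0,1\}^*$, $x\in L$ if and only if $f(x)$ is a yes-instance. -/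

import Mathlib

namespace IterElim

/-! ### Iterated elimination in two-player games

A game is a pair of `n × m` payoff matrices `A` (row player) and `B` (column player).
A subgame is a pair `(I, J)` of sets of remaining strategies.  Domination between columns with
respect to `B` is domination between rows with respect to the transposed matrix. -/

section Elimination

open Matrix

variable {n m : ℕ}

/-- Row `i` is weakly dominated in the subgame `(I, J)` by some *other* remaining row. -/
def WeaklyDominated (A : Matrix (Fin n) (Fin m) ℤ) (I : Finset (Fin n)) (J : Finset (Fin m))
    (i : Fin n) : Prop :=
  ∃ i₀ ∈ I, i₀ ≠ i ∧ ∀ j ∈ J, A i₀ j ≥ A i j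

/-- Row `i` is dominated in the subgame `(I, J)`. -/
def Dominated (A : Matrix (Fin n) (Fin m) ℤ) (I : Finset (Fin n)) (J : Finset (Fin m))
    (i : Fin n) : Prop :=
  ∃ i₀ ∈ I, (∀ j ∈ J, A i₀ j ≥ A i j) ∧ ∃ j₀ ∈ J, A i₀ j₀ > A i j₀

/-- One elimination of a weakly dominated strategy of either player. -/
inductive WeakStep (A B : Matrix (Fin n) (Fin m) ℤ) :
    Finset (Fin n) × Finset (Fin m) → Finset (Fin n) × Finset (Fin m) → Prop
  | row (I : Finset (Fin n)) (J : Finset (Fin m)) (i : Fin n) (hi : i ∈ I)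
      (h : WeaklyDominated A I J i) : WeakStep A B (I, J) (I.erase i, J)
  | col (I : Finset (Fin n)) (J : Finset (Fin m)) (j : Fin m) (hj : j ∈ J)
      (h : WeaklyDominated Bᵀ J I j) : WeakStep A B (I, J) (I, J.erase j)

/-- One elimination of a dominated strategy of either player. -/
inductive DominanceStep (A B : Matrix (Fin n) (Fin m) ℤ) :
    Finset (Fin n) × Finset (Fin m) → Finset (Fin n) × Finset (Fin m) → Prop
  | row (I : Finset (Fin n)) (J : Finset (Fin m)) (i : Fin n) (hi : i ∈ I)
      (h : Dominated A I J i) : DominanceStep A B (I, J) (I.erase i, J)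
  | col (I : Finset (Fin n)) (J : Finset (Fin m)) (j : Fin m) (hj : j ∈ J)
      (h : Dominated Bᵀ J I j) : DominanceStep A B (I, J) (I, J.erase j)

/-- One simultaneous elimination: `(K, L)` is maximal among the pairs of sets of remaining
strategies all of whose members are dominated in `(I, J)`. -/
inductive SimultaneousStep (A B : Matrix (Fin n) (Fin m) ℤ) :
    Finset (Fin n) × Finset (Fin m) → Finset (Fin n) × Finset (Fin m) → Prop
  | mk (I : Finset (Fin n)) (J : Finset (Fin m)) (K : Finset (Fin n)) (L : Finset (Fin m))
      (h : Maximal (fun S : Finset (Fin n) × Finset (Fin m) =>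
        S.1 ⊆ I ∧ S.2 ⊆ J ∧ (∀ k ∈ S.1, Dominated A I J k) ∧ ∀ l ∈ S.2, Dominated Bᵀ J I l)
        (K, L)) : SimultaneousStep A B (I, J) (I \ K, J \ L)

end Elimination

/-! ### Decision problems -/

/-- A decision problem: instances, an (injective) encoding of instances as words over a finite
alphabet, and the set of yes-instances. -/
structure DecisionProblem where
  Inst : Type
  Sym : Type
  finSym : Finite Sym
  encode : Inst → List Sym
  encode_injective : Function.Injective encode
  Yes : Inst → Prop

/-- The restriction of a problem to the instances with property `S`. -/
def DecisionProblem.restrict (P : DecisionProblem) (S : P.Inst → Prop) : DecisionProblem where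
  Inst := {x : P.Inst // S x}
  Sym := P.Sym
  finSym := P.finSym
  encode x := P.encode x.1
  encode_injective := P.encode_injective.comp Subtype.val_injective
  Yes x := P.Yes x.1

/-- An `n × m` game `(A, B)` with nonempty strategy sets and integer payoffs, together with a
designated strategy of the row player. -/
structure GameInstance where
  n : ℕ
  m : ℕ
  m_pos : 0 < m
  A : Matrix (Fin n) (Fin m) ℤ
  B : Matrix (Fin n) (Fin m) ℤ
  i : Fin n

/-- The alphabet used to write down games. -/
inductive GameSym
  | bit (b : Bool)
  | minus
  | comma
  | newline
  deriving Fintype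

/-- Binary notation of a natural number, least significant bit first. -/
def encodeNat (k : ℕ) : List GameSym := k.bits.map GameSym.bit

/-- Binary notation of an integer, with a minus sign if it is negative. -/
def encodeInt : ℤ → List GameSym
  | Int.ofNat k => encodeNat k
  | Int.negSucc k => GameSym.minus :: encodeNat (k + 1)

/-- A pair of payoffs, each followed by a comma. -/
def encodeEntry (p : ℤ × ℤ) : List GameSym :=
  encodeInt p.1 ++ GameSym.comma :: (encodeInt p.2 ++ [GameSym.comma])

/-- A row of the bimatrix. -/
def encodeRow (r : List (ℤ × ℤ)) : List GameSym := r.flatMap encodeEntry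

/-- The index of the designated strategy in binary, followed by the rows of the bimatrix
`(A i j, B i j)`; each of these is terminated by `newline`. -/
def GameInstance.encode (g : GameInstance) : List GameSym :=
  encodeNat g.i ++ GameSym.newline ::
    (List.ofFn fun i => List.ofFn fun j => (g.A i j, g.B i j)).flatMap
      fun r => encodeRow r ++ [GameSym.newline]

theorem encodeNat_injective : Function.Injective encodeNat := by
  intro a b h
  have h1 : a.bits = b.bits :=
    List.map_injective_iff.2 (fun x y hxy => by cases hxy; rfl) h
  apply Nat.digits.injective 2
  rw [Nat.digits_two_eq_bits, Nat.digits_two_eq_bits, h1]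

theorem append_cons_cancel {α : Type} {c : α} : ∀ {u v s t : List α}, c ∉ u → c ∉ v →
    u ++ c :: s = v ++ c :: t → u = v ∧ s = t
  | [], [], _, _, _, _, h => ⟨rfl, (List.cons.inj h).2⟩
  | [], _ :: _, _, _, _, hv, h => absurd (List.cons.inj h).1 fun e => hv (by simp [e])
  | _ :: _, [], _, _, hu, _, h => absurd (List.cons.inj h).1 fun e => hu (by simp [e])
  | a :: u, b :: v, s, t, hu, hv, h => by
    obtain ⟨h1, h2⟩ := List.cons.inj h
    obtain ⟨h3, h4⟩ := append_cons_cancel (fun e => hu (List.mem_cons_of_mem _ e))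
      (fun e => hv (List.mem_cons_of_mem _ e)) h2
    exact ⟨by rw [h1, h3], h4⟩

theorem comma_notMem_encodeInt (z : ℤ) : GameSym.comma ∉ encodeInt z := by
  cases z <;> simp [encodeInt, encodeNat]

theorem newline_notMem_encodeInt (z : ℤ) : GameSym.newline ∉ encodeInt z := by
  cases z <;> simp [encodeInt, encodeNat]

theorem encodeInt_injective : Function.Injective encodeInt := by
  intro a b h
  rcases a with a | a <;> rcases b with b | b
  · exact congrArg Int.ofNat (encodeNat_injective h)
  · have : GameSym.minus ∈ encodeInt (Int.ofNat a) := by rw [h]; simp [encodeInt]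
    simp [encodeInt, encodeNat] at this
  · have : GameSym.minus ∈ encodeInt (Int.ofNat b) := by rw [← h]; simp [encodeInt]
    simp [encodeInt, encodeNat] at this
  · have := encodeNat_injective (List.cons.inj h).2
    congr 1
    omega

theorem encodeRow_injective : Function.Injective encodeRow := by
  intro r
  induction r with
  | nil =>
    intro s h
    cases s with
    | nil => rfl
    | cons p s => simp [encodeRow, encodeEntry] at h
  | cons p r ih =>
    intro s h
    cases s with
    | nil => simp [encodeRow, encodeEntry] at h
    | cons q s =>
      simp only [encodeRow, encodeEntry, List.flatMap_cons, List.append_assoc, List.cons_append,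
        List.nil_append] at h
      obtain ⟨h1, h2⟩ := append_cons_cancel
        (comma_notMem_encodeInt _) (comma_notMem_encodeInt _) h
      obtain ⟨h3, h4⟩ := append_cons_cancel
        (comma_notMem_encodeInt _) (comma_notMem_encodeInt _) h2
      rw [ih h4, Prod.ext (encodeInt_injective h1) (encodeInt_injective h3)]

theorem newline_notMem_encodeRow (r : List (ℤ × ℤ)) : GameSym.newline ∉ encodeRow r := by
  simp [encodeRow, encodeEntry, newline_notMem_encodeInt]

theorem encodeRows_injective : Function.Injective fun l : List (List (ℤ × ℤ)) =>
    l.flatMap fun r => encodeRow r ++ [GameSym.newline] := by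
  intro r
  induction r with
  | nil =>
    intro s h
    cases s with
    | nil => rfl
    | cons p s => simp at h
  | cons p r ih =>
    intro s h
    cases s with
    | nil => simp at h
    | cons q s =>
      simp only [List.flatMap_cons, List.append_assoc, List.cons_append, List.nil_append] at h
      obtain ⟨h1, h2⟩ := append_cons_cancel
        (newline_notMem_encodeRow _) (newline_notMem_encodeRow _) h
      rw [ih h2, encodeRow_injective h1]

theorem GameInstance.encode_injective : Function.Injective GameInstance.encode := by
  rintro ⟨n, m, hm, A, B, i⟩ ⟨n', m', hm', A', B', i'⟩ h
  obtain ⟨h1, h2⟩ := append_cons_cancel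
        (by simp [encodeNat]) (by simp [encodeNat]) h
  have h3 := encodeRows_injective h2
  have hn : n = n' := by simpa using congrArg List.length h3
  subst hn
  have h4 := List.ofFn_injective h3
  have hm2 : m = m' := by simpa using congrArg List.length (congrFun h4 i)
  subst hm2
  have h5 : ∀ a b, (A a b, B a b) = (A' a b, B' a b) := fun a b =>
    congrFun (List.ofFn_injective (congrFun h4 a)) b
  have hA : A = A' := by ext a b; exact (Prod.ext_iff.1 (h5 a b)).1
  have hB : B = B' := by ext a b; exact (Prod.ext_iff.1 (h5 a b)).2
  have hi : i = i' := Fin.ext (encodeNat_injective h1)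
  subst hA hB hi
  rfl

/-- The problem whether the designated strategy of the row player can be removed by a finite
sequence of steps of the given elimination relation, starting with the full game. -/
def eliminationProblem
    (Step : ∀ {n m : ℕ}, Matrix (Fin n) (Fin m) ℤ → Matrix (Fin n) (Fin m) ℤ →
      Finset (Fin n) × Finset (Fin m) → Finset (Fin n) × Finset (Fin m) → Prop) :
    DecisionProblem where
  Inst := GameInstance
  Sym := GameSym
  finSym := inferInstance
  encode := GameInstance.encode
  encode_injective := GameInstance.encode_injective
  Yes g := ∃ (I : Finset (Fin g.n)) (J : Finset (Fin g.m)),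
    Relation.ReflTransGen (Step g.A g.B) (Finset.univ, Finset.univ) (I, J) ∧ g.i ∉ I

/-- At most `k` different values occur in the two payoff matrices. -/
def GameInstance.AtMostValues (k : ℕ) (g : GameInstance) : Prop :=
  {v : ℤ | ∃ i j, g.A i j = v ∨ g.B i j = v}.ncard ≤ k

/-- The game is zero-sum. -/
def GameInstance.ZeroSum (g : GameInstance) : Prop :=
  ∀ i j, g.A i j + g.B i j = 0

/-- The problem `k-Z-Weak`. -/
def kZWeak (k : ℕ) : DecisionProblem :=
  (eliminationProblem WeakStep).restrict
    fun g : GameInstance => g.AtMostValues k ∧ g.ZeroSum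

/-- The problem `k-Z-Dominance`. -/
def kZDominance (k : ℕ) : DecisionProblem :=
  (eliminationProblem DominanceStep).restrict
    fun g : GameInstance => g.AtMostValues k ∧ g.ZeroSum

/-- The problem `k-Z-Simultaneous`. -/
def kZSimultaneous (k : ℕ) : DecisionProblem :=
  (eliminationProblem SimultaneousStep).restrict
    fun g : GameInstance => g.AtMostValues k ∧ g.ZeroSum

/-! ### The class P -/

/-- `L` is decided by a deterministic one-tape Turing machine in polynomial time.  The machine has
finitely many states `Λ` (initial state `default`) and tape symbols `Γ` (blank `default`), reads
the input through an injection of `{0, 1}` into the non-blank symbols, and accepts by halting in a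
state of `acc`. -/
def InP (L : Set (List Bool)) : Prop :=
  ∃ (Γ Λ : Type) (_ : Inhabited Γ) (_ : Inhabited Λ) (_ : Finite Γ) (_ : Finite Λ)
    (M : Turing.TM0.Machine Γ Λ) (sym : Bool → Γ) (acc : Set Λ) (time : Polynomial ℕ),
    Function.Injective sym ∧ (∀ b, sym b ≠ default) ∧
    ∀ x : List Bool, ∃ c : Turing.TM0.Cfg Γ Λ,
      Nonempty (StateTransition.EvalsToInTime (Turing.TM0.step M)
        (Turing.TM0.init (x.map sym)) (some c) (time.eval x.length)) ∧
      Turing.TM0.step M c = none ∧ (c.q ∈ acc ↔ x ∈ L)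

/-! ### Logarithmic space transducers -/

/-- Head movements. -/
inductive Move
  | left
  | stay
  | right

/-- Symbols seen by the input head: the input word between two end markers. -/
inductive InputSym
  | leftEnd
  | bit (b : Bool)
  | rightEnd

/-- What a transducer with `k` work tapes does in one step. -/
structure Action (Q Γ Out : Type) (k : ℕ) where
  state : Q
  inputMove : Move
  write : Fin k → Γ
  workMove : Fin k → Move
  output : Option Out

/-- A deterministic Turing machine with a two-way read-only input tape, `k` two-way infinite work
tapes and a one-way write-only output tape.  It halts when `δ` returns `none`. -/
structure Transducer (Out : Type) where
  Q : Type
  Γ : Type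
  finQ : Finite Q
  finΓ : Finite Γ
  k : ℕ
  start : Q
  blank : Γ
  δ : Q → InputSym → (Fin k → Γ) → Option (Action Q Γ Out k)

/-- A configuration.  The input head position ranges over `0, …, |x| + 1`, where `0` and `|x| + 1`
carry the end markers. -/
structure Transducer.Cfg {Out : Type} (M : Transducer Out) where
  state : M.Q
  inputHead : ℕ
  tape : Fin M.k → ℤ → M.Γ
  head : Fin M.k → ℤ
  output : List Out

/-- The symbol at position `p` of the input tape. -/
def readInput (x : List Bool) : ℕ → InputSym
  | 0 => InputSym.leftEnd
  | p + 1 => match x[p]? with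
    | some b => InputSym.bit b
    | none => InputSym.rightEnd

/-- Movement of the input head on an input of length `len`; the head never leaves the part of
the tape delimited by the end markers. -/
def Move.onInput (len : ℕ) : Move → ℕ → ℕ
  | Move.left, p => p - 1
  | Move.stay, p => p
  | Move.right, p => min (p + 1) (len + 1)

/-- Movement of a work head. -/
def Move.onWork : Move → ℤ → ℤ
  | Move.left, p => p - 1
  | Move.stay, p => p
  | Move.right, p => p + 1

namespace Transducer

variable {Out : Type} (M : Transducer Out)

/-- The initial configuration: the input head is on the first cell right of the left end marker,
the work tapes and the output are empty. -/
def init : M.Cfg where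
  state := M.start
  inputHead := 1
  tape := fun _ _ => M.blank
  head := fun _ => 0
  output := []

/-- One step of the computation on input `x`. -/
def step (x : List Bool) (c : M.Cfg) : Option M.Cfg :=
  (M.δ c.state (readInput x c.inputHead) fun t => c.tape t (c.head t)).map fun a =>
    { state := a.state
      inputHead := a.inputMove.onInput x.length c.inputHead
      tape := fun t => Function.update (c.tape t) (c.head t) (a.write t)
      head := fun t => (a.workMove t).onWork (c.head t)
      output := c.output ++ a.output.toList }

/-- On input `x` the machine halts with output `y`. -/
def Computes (x : List Bool) (y : List Out) : Prop :=
  ∃ c : M.Cfg, StateTransition.Reaches (M.step x) M.init c ∧ M.step x c = none ∧ c.output = y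

/-- On input `x` no work head ever leaves the cells `-s, …, s`. -/
def SpaceBoundedOn (x : List Bool) (s : ℕ) : Prop :=
  ∀ c : M.Cfg, StateTransition.Reaches (M.step x) M.init c → ∀ t, (c.head t).natAbs ≤ s

end Transducer

/-- `f` is computed by a Turing machine in logarithmic space. -/
def LogSpaceComputable {Out : Type} (f : List Bool → List Out) : Prop :=
  ∃ (M : Transducer Out) (c : ℕ), ∀ x : List Bool,
    M.Computes x (f x) ∧ M.SpaceBoundedOn x (c * (Nat.log 2 x.length + 1))

/-- `P` is hard for the class P under logarithmic space many-one reductions: for every language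
in P there is a map into the instances of `P` that preserves the answer and whose encoded value
is computable in logarithmic space. -/
def PHard (P : DecisionProblem) : Prop :=
  ∀ L : Set (List Bool), InP L → ∃ f : List Bool → P.Inst,
    LogSpaceComputable (fun x => P.encode (f x)) ∧ ∀ x, x ∈ L ↔ P.Yes (f x)

end IterElim

/-!
Hardness is proved by one reduction that serves all three kinds of elimination.

*A game in which the order of elimination is irrelevant.* A `Certificate` for a zero-sum game
consists of sets `R`, `C` of strategies no member of which is weakly dominated over `R`, `C` by any
other strategy of the whole game, such that every other strategy is dominated by one in `R`, `C`
once all strategies of smaller rank have gone. As the dominating strategies are never lost, weak,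
ordinary and simultaneous elimination all remove exactly the strategies outside `R`, `C`
(`Certificate.removable_iff_weak` and its companions).

*Horn clauses.* `HornSystem.payoff` turns a system of Horn clauses into a game with payoffs
`-1`, `0`, `1`, in which the row and the column of a variable are removable iff the variable is
derivable: the row `var v` is dominated by the row of a clause for `v` once the columns of the
variables in the body have gone, and the column `var v` is dominated by a fixed column once the row
`var v` has gone (`HornSystem.certificate`).

*Computations.* The tape of a Turing machine is viewed relative to its head, with the machine's
state copied to every cell. If the tape is also bent to a sufficiently long ring, then the content
of a cell after a step depends on the contents of two cells before the step, by a rule that is the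
same everywhere (`RingMachine`, `content_ringMachine_eq_flag`). The derivation of all contents of
cells by Horn clauses gives the game.

*Logarithmic space.* An entry of the game depends on the input symbol of the cell of the row and on
comparisons of the cells and times of the row and the column (`RingMachine.entry_eq_payoff`). All
comparisons are made in one pass through the digits of counters, which also advances a counter.
So a machine that works in sweeps over a word of logarithmic length suffices
(`RingMachine.writer_computes`), and it is easily turned into a transducer
(`Sweeper.toTransducer_computes`). Since the number of cells of the ring and the number of steps are
the same power of the base of the counters, the end of each loop is the overflow of a counter, and
no arithmetic is needed.
-/

namespace IterElim

/-! ### Games in which the result of the elimination does not depend on the order -/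

/-- A certificate that iterated elimination in the zero-sum game with payoffs `a` (rows maximize,
columns minimize) ends with the rows in `R` and the columns in `C`, whatever the order of the
steps: no strategy of `R`, `C` is weakly dominated, not even by a strategy outside these sets, and
each other strategy is dominated by one from `R`, `C` as soon as all strategies of smaller rank
outside `R`, `C` have been removed. -/
structure Certificate {X Y : Type*} (a : X → Y → ℤ) (R : Set X) (C : Set Y)
    (rr : X → ℕ) (rc : Y → ℕ) : Prop where
  row_safe : ∀ i ∈ R, ∀ i₀, i₀ ≠ i → ∃ j ∈ C, a i₀ j < a i j
  col_safe : ∀ j ∈ C, ∀ j₀, j₀ ≠ j → ∃ i ∈ R, a i j < a i j₀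
  row_elim : ∀ i, i ∉ R → ∃ i₀ ∈ R, (∃ j ∈ C, a i j < a i₀ j) ∧
    ∀ j, a i₀ j < a i j → j ∉ C ∧ rc j < rr i
  col_elim : ∀ j, j ∉ C → ∃ j₀ ∈ C, (∃ i ∈ R, a i j₀ < a i j) ∧
    ∀ i, a i j < a i j₀ → i ∉ R ∧ rr i < rc j

theorem Certificate.comap {X Y X' Y' : Type*} {a : X → Y → ℤ} {R : Set X} {C : Set Y}
    {rr : X → ℕ} {rc : Y → ℕ} (h : Certificate a R C rr rc) {f : X' → X} {g : Y' → Y}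
    (hf : Function.Bijective f) (hg : Function.Bijective g) :
    Certificate (fun i j => a (f i) (g j)) (f ⁻¹' R) (g ⁻¹' C) (rr ∘ f) (rc ∘ g) where
  row_safe i hi i₀ h0 := by
    obtain ⟨j, hj, hlt⟩ := h.row_safe (f i) hi (f i₀) (fun e => h0 (hf.1 e))
    obtain ⟨j, rfl⟩ := hg.2 j
    exact ⟨j, hj, hlt⟩
  col_safe j hj j₀ h0 := by
    obtain ⟨i, hi, hlt⟩ := h.col_safe (g j) hj (g j₀) (fun e => h0 (hg.1 e))
    obtain ⟨i, rfl⟩ := hf.2 i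
    exact ⟨i, hi, hlt⟩
  row_elim i hi := by
    obtain ⟨i₀, h0, ⟨j, hj, hlt⟩, hr⟩ := h.row_elim (f i) hi
    obtain ⟨i₀, rfl⟩ := hf.2 i₀
    obtain ⟨j, rfl⟩ := hg.2 j
    exact ⟨i₀, h0, ⟨j, hj, hlt⟩, fun j h => hr (g j) h⟩
  col_elim j hj := by
    obtain ⟨j₀, h0, ⟨i, hi, hlt⟩, hr⟩ := h.col_elim (g j) hj
    obtain ⟨j₀, rfl⟩ := hg.2 j₀
    obtain ⟨i, rfl⟩ := hf.2 i
    exact ⟨j₀, h0, ⟨i, hi, hlt⟩, fun i h => hr (f i) h⟩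

section

variable {n m : ℕ} {A B : Matrix (Fin n) (Fin m) ℤ} {R : Set (Fin n)} {C : Set (Fin m)}
  {rr : Fin n → ℕ} {rc : Fin m → ℕ}

theorem Dominated.weaklyDominated {I : Finset (Fin n)} {J : Finset (Fin m)} {i : Fin n}
    (h : Dominated A I J i) : WeaklyDominated A I J i := by
  obtain ⟨i₀, h0, h1, j₀, -, h2⟩ := h
  exact ⟨i₀, h0, fun e => by subst e; exact lt_irrefl _ h2, h1⟩

theorem DominanceStep.weakStep {s t : Finset (Fin n) × Finset (Fin m)}
    (h : DominanceStep A B s t) : WeakStep A B s t := by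
  cases h with
  | row I J i hi h => exact .row I J i hi h.weaklyDominated
  | col I J j hj h => exact .col I J j hj h.weaklyDominated

/-- The subgame `s` still contains all strategies of `R` and `C`. -/
def Keeps (R : Set (Fin n)) (C : Set (Fin m)) (s : Finset (Fin n) × Finset (Fin m)) : Prop :=
  (∀ i ∈ R, i ∈ s.1) ∧ ∀ j ∈ C, j ∈ s.2

theorem Certificate.not_weaklyDominated_row (h : Certificate A R C rr rc)
    {I : Finset (Fin n)} {J : Finset (Fin m)} (hk : Keeps R C (I, J)) {i : Fin n}
    (hd : WeaklyDominated A I J i) : i ∉ R := by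
  intro hi
  obtain ⟨i₀, -, hne, hge⟩ := hd
  obtain ⟨j, hj, hlt⟩ := h.row_safe i hi i₀ hne
  exact absurd (hge j (hk.2 j hj)) (by simpa using hlt)

theorem Certificate.not_weaklyDominated_col (h : Certificate A R C rr rc)
    (hB : ∀ i j, A i j + B i j = 0)
    {I : Finset (Fin n)} {J : Finset (Fin m)} (hk : Keeps R C (I, J)) {j : Fin m}
    (hd : WeaklyDominated B.transpose J I j) : j ∉ C := by
  intro hj
  obtain ⟨j₀, -, hne, hge⟩ := hd
  obtain ⟨i, hi, hlt⟩ := h.col_safe j hj j₀ hne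
  have := hge i (hk.1 i hi)
  simp only [Matrix.transpose_apply] at this
  have := hB i j
  have := hB i j₀
  omega

theorem Certificate.keeps_weakStep (h : Certificate A R C rr rc) (hB : ∀ i j, A i j + B i j = 0)
    {s t : Finset (Fin n) × Finset (Fin m)} (hk : Keeps R C s) (hs : WeakStep A B s t) :
    Keeps R C t := by
  cases hs with
  | row I J i hi hd =>
    refine ⟨fun i' hi' => Finset.mem_erase.2 ⟨?_, hk.1 i' hi'⟩, hk.2⟩
    rintro rfl
    exact h.not_weaklyDominated_row hk hd hi'
  | col I J j hj hd =>
    refine ⟨hk.1, fun j' hj' => Finset.mem_erase.2 ⟨?_, hk.2 j' hj'⟩⟩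
    rintro rfl
    exact h.not_weaklyDominated_col hB hk hd hj'

theorem Certificate.keeps_simultaneousStep (h : Certificate A R C rr rc)
    (hB : ∀ i j, A i j + B i j = 0) {s t : Finset (Fin n) × Finset (Fin m)} (hk : Keeps R C s)
    (hs : SimultaneousStep A B s t) : Keeps R C t := by
  cases hs with
  | mk I J K L hm =>
    obtain ⟨-, -, hK, hL⟩ := hm.prop
    exact ⟨fun i hi => Finset.mem_sdiff.2 ⟨hk.1 i hi, fun hiK =>
        h.not_weaklyDominated_row hk (hK i hiK).weaklyDominated hi⟩,
      fun j hj => Finset.mem_sdiff.2 ⟨hk.2 j hj, fun hjL =>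
        h.not_weaklyDominated_col hB hk (hL j hjL).weaklyDominated hj⟩⟩

/-- A remaining strategy outside `R` and `C` whose rank is minimal is dominated. -/
theorem Certificate.exists_dominated (h : Certificate A R C rr rc)
    (hB : ∀ i j, A i j + B i j = 0) {I : Finset (Fin n)} {J : Finset (Fin m)}
    (hk : Keeps R C (I, J)) {i : Fin n} (hi : i ∈ I) (hiR : i ∉ R) :
    (∃ k ∈ I, Dominated A I J k) ∨ ∃ l ∈ J, Dominated B.transpose J I l := by
  classical
  let P : ℕ → Prop := fun r => (∃ k ∈ I, k ∉ R ∧ rr k = r) ∨ ∃ l ∈ J, l ∉ C ∧ rc l = r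
  have hP : ∃ r, P r := ⟨rr i, Or.inl ⟨i, hi, hiR, rfl⟩⟩
  have hmin : ∀ r, P r → Nat.find hP ≤ r := fun r hr => Nat.find_min' hP hr
  rcases Nat.find_spec hP with ⟨k, hk1, hk2, hk3⟩ | ⟨l, hl1, hl2, hl3⟩
  · left
    obtain ⟨i₀, h0, ⟨j, hj, hlt⟩, hr⟩ := h.row_elim k hk2
    refine ⟨k, hk1, i₀, hk.1 _ h0, fun j' hj' => ?_, j, hk.2 j hj, hlt⟩
    by_contra hc
    obtain ⟨h1, h2⟩ := hr j' (not_le.1 hc)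
    have := hmin _ (Or.inr ⟨j', hj', h1, rfl⟩)
    omega
  · right
    obtain ⟨j₀, h0, ⟨i', hi', hlt⟩, hr⟩ := h.col_elim l hl2
    refine ⟨l, hl1, j₀, hk.2 _ h0, fun i'' hi'' => ?_, i', hk.1 i' hi', ?_⟩
    · by_contra hc
      simp only [Matrix.transpose_apply] at hc
      have e1 := hB i'' l
      have e2 := hB i'' j₀
      obtain ⟨h1, h2⟩ := hr i'' (by omega)
      have := hmin _ (Or.inl ⟨i'', hi'', h1, rfl⟩)
      omega
    · simp only [Matrix.transpose_apply]
      have e1 := hB i' l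
      have e2 := hB i' j₀
      omega

/-- The set of pairs of dominated rows and dominated columns has a maximal element, which contains
every dominated row and every dominated column. -/
theorem exists_simultaneousStep (A B : Matrix (Fin n) (Fin m) ℤ) (I : Finset (Fin n))
    (J : Finset (Fin m)) : ∃ K L, SimultaneousStep A B (I, J) (I \ K, J \ L) ∧
      (∀ k ∈ I, Dominated A I J k → k ∈ K) ∧ ∀ l ∈ J, Dominated B.transpose J I l → l ∈ L := by
  classical
  refine ⟨I.filter (Dominated A I J), J.filter (Dominated B.transpose J I), .mk I J _ _
    ⟨⟨Finset.filter_subset _ _, Finset.filter_subset _ _, fun k hk => (Finset.mem_filter.1 hk).2,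
      fun l hl => (Finset.mem_filter.1 hl).2⟩, ?_⟩,
    fun k hk hd => Finset.mem_filter.2 ⟨hk, hd⟩, fun l hl hd => Finset.mem_filter.2 ⟨hl, hd⟩⟩
  rintro ⟨K, L⟩ ⟨h1, h2, h3, h4⟩ -
  exact ⟨fun k hk => Finset.mem_filter.2 ⟨h1 hk, h3 k hk⟩,
    fun l hl => Finset.mem_filter.2 ⟨h2 hl, h4 l hl⟩⟩

/-- If a step relation preserves the strategies of `R` and `C` and makes progress as long as a row
outside `R` is left, then it can remove exactly the rows outside `R`. -/
theorem removable_iff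
    {Step : Finset (Fin n) × Finset (Fin m) → Finset (Fin n) × Finset (Fin m) → Prop}
    (hkeep : ∀ s t, Keeps R C s → Step s t → Keeps R C t)
    (hprog : ∀ s, Keeps R C s → ∀ i ∈ s.1, i ∉ R →
      ∃ t, Step s t ∧ t.1.card + t.2.card < s.1.card + s.2.card) (i : Fin n) :
    (∃ (I : Finset (Fin n)) (J : Finset (Fin m)),
      Relation.ReflTransGen Step (Finset.univ, Finset.univ) (I, J) ∧ i ∉ I) ↔ i ∉ R := by
  constructor
  · rintro ⟨I, J, hr, hi⟩ hiR
    have : ∀ t, Relation.ReflTransGen Step (Finset.univ, Finset.univ) t → Keeps R C t := by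
      intro t ht
      induction ht with
      | refl => exact ⟨fun _ _ => Finset.mem_univ _, fun _ _ => Finset.mem_univ _⟩
      | tail _ h ih => exact hkeep _ _ ih h
    exact hi ((this _ hr).1 i hiR)
  · intro hiR
    have key : ∀ (N : ℕ) (s : Finset (Fin n) × Finset (Fin m)), s.1.card + s.2.card ≤ N →
        Keeps R C s → ∃ t, Relation.ReflTransGen Step s t ∧ i ∉ t.1 := by
      intro N
      induction N with
      | zero =>
        intro s hs _
        have : s.1 = ∅ := Finset.card_eq_zero.1 (by omega)
        exact ⟨s, .refl, by simp [this]⟩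
      | succ N ih =>
        intro s hs hk
        by_cases hi : i ∈ s.1
        · obtain ⟨t, ht, hlt⟩ := hprog s hk i hi hiR
          obtain ⟨u, hu, hiu⟩ := ih t (by omega) (hkeep _ _ hk ht)
          exact ⟨u, .head ht hu, hiu⟩
        · exact ⟨s, .refl, hi⟩
    obtain ⟨t, ht, hi⟩ := key _ (Finset.univ, Finset.univ) le_rfl
      ⟨fun _ _ => Finset.mem_univ _, fun _ _ => Finset.mem_univ _⟩
    exact ⟨t.1, t.2, ht, hi⟩

theorem Certificate.exists_dominanceStep (h : Certificate A R C rr rc)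
    (hB : ∀ i j, A i j + B i j = 0) (s : Finset (Fin n) × Finset (Fin m)) (hk : Keeps R C s)
    (i : Fin n) (hi : i ∈ s.1) (hiR : i ∉ R) :
    ∃ t, DominanceStep A B s t ∧ t.1.card + t.2.card < s.1.card + s.2.card := by
  obtain ⟨I, J⟩ := s
  rcases h.exists_dominated hB hk hi hiR with ⟨k, hk, hd⟩ | ⟨l, hl, hd⟩
  · refine ⟨_, .row I J k hk hd, ?_⟩
    have := Finset.card_erase_lt_of_mem hk
    dsimp only
    omega
  · refine ⟨_, .col I J l hl hd, ?_⟩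
    have := Finset.card_erase_lt_of_mem hl
    dsimp only
    omega

theorem Certificate.removable_iff_dominance (h : Certificate A R C rr rc)
    (hB : ∀ i j, A i j + B i j = 0) (i : Fin n) :
    (∃ (I : Finset (Fin n)) (J : Finset (Fin m)),
      Relation.ReflTransGen (DominanceStep A B) (Finset.univ, Finset.univ) (I, J) ∧ i ∉ I) ↔
      i ∉ R :=
  removable_iff (fun _ _ hk hs => h.keeps_weakStep hB hk hs.weakStep)
    (h.exists_dominanceStep hB) i

theorem Certificate.removable_iff_weak (h : Certificate A R C rr rc)
    (hB : ∀ i j, A i j + B i j = 0) (i : Fin n) :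
    (∃ (I : Finset (Fin n)) (J : Finset (Fin m)),
      Relation.ReflTransGen (WeakStep A B) (Finset.univ, Finset.univ) (I, J) ∧ i ∉ I) ↔ i ∉ R :=
  removable_iff (fun _ _ hk hs => h.keeps_weakStep hB hk hs)
    (fun s hk i hi hiR => (h.exists_dominanceStep hB s hk i hi hiR).imp
      fun _ ht => ⟨ht.1.weakStep, ht.2⟩) i

theorem Certificate.removable_iff_simultaneous (h : Certificate A R C rr rc)
    (hB : ∀ i j, A i j + B i j = 0) (i : Fin n) :
    (∃ (I : Finset (Fin n)) (J : Finset (Fin m)),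
      Relation.ReflTransGen (SimultaneousStep A B) (Finset.univ, Finset.univ) (I, J) ∧ i ∉ I) ↔
      i ∉ R := by
  refine removable_iff (fun _ _ hk hs => h.keeps_simultaneousStep hB hk hs) ?_ i
  rintro ⟨I, J⟩ hk i hi hiR
  obtain ⟨K, L, hs, hK, hL⟩ := exists_simultaneousStep A B I J
  refine ⟨_, hs, ?_⟩
  have h1 := Finset.card_le_card (Finset.sdiff_subset (s := I) (t := K))
  have h2 := Finset.card_le_card (Finset.sdiff_subset (s := J) (t := L))
  rcases h.exists_dominated hB hk hi hiR with ⟨k, hk, hd⟩ | ⟨l, hl, hd⟩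
  · have : (I \ K).card < I.card := Finset.card_lt_card
      (Finset.ssubset_iff_subset_ne.2 ⟨Finset.sdiff_subset, fun e =>
        (Finset.mem_sdiff.1 (e ▸ hk)).2 (hK k hk hd)⟩)
    dsimp only
    omega
  · have : (J \ L).card < J.card := Finset.card_lt_card
      (Finset.ssubset_iff_subset_ne.2 ⟨Finset.sdiff_subset, fun e =>
        (Finset.mem_sdiff.1 (e ▸ hl)).2 (hL l hl hd)⟩)
    dsimp only
    omega

end

/-! ### The game of a Horn system -/

/-- A system of Horn clauses `head d ← body d` over the variables `V`. -/
structure HornSystem (V D : Type*) where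
  head : D → V
  body : D → Set V

/-- The rows of the game of a Horn system: one for each variable, one for each clause, and two
rows that protect columns from being dominated. -/
inductive HornRow (V D : Type*)
  | var (v : V)
  | clause (d : D)
  | anchor (s : Bool)

/-- The columns of the game of a Horn system.  The column `var u` disappears once the row `var u`
has disappeared; `head u` ties the rows of clauses to the rows of their heads; `clause d` protects
the row `clause d`, and `anchor s` the row `anchor s`. -/
inductive HornCol (V D : Type*)
  | var (u : V)
  | head (u : V)
  | clause (d : D)
  | anchor (s : Bool)

namespace HornSystem

variable {V D : Type*} (H : HornSystem V D)

open Classical in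
/-- The payoffs of the row player. The row of a clause is worse than the row of its head only
in the columns of the variables of its body, and the column `var u` is better for the column
player than the column `anchor false` only in the row `var u`. -/
noncomputable def payoff : HornRow V D → HornCol V D → ℤ
  | .var v, .var u => if u = v then -1 else 1
  | .var v, .head u => if u = v then 1 else 0
  | .var _, .clause _ => 0
  | .var _, .anchor _ => 0
  | .clause d, .var u => if u ∈ H.body d then 0 else 1
  | .clause d, .head u => if u = H.head d then 1 else 0
  | .clause d, .clause d' => if d' = d then 1 else 0
  | .clause _, .anchor _ => 0
  | .anchor _, .var _ => 1
  | .anchor s, .head _ => if s then 0 else -1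
  | .anchor s, .clause _ => if s then -1 else 0
  | .anchor s, .anchor s' => if s' = s then 1 else -1

theorem payoff_mem (r : HornRow V D) (c : HornCol V D) :
    H.payoff r c = -1 ∨ H.payoff r c = 0 ∨ H.payoff r c = 1 := by
  cases r <;> cases c <;> unfold payoff <;> dsimp only <;> (try split_ifs) <;> simp

/-- The rows that survive the elimination if `T` is the set of derivable variables. -/
def keptRows (D : Type*) (T : Set V) : Set (HornRow V D)
  | .var v => v ∉ T
  | _ => True

/-- The columns that survive the elimination if `T` is the set of derivable variables. -/
def keptCols (D : Type*) (T : Set V) : Set (HornCol V D)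
  | .var v => v ∉ T
  | _ => True

/-- The row of a variable of rank `k` disappears before its column, and both after the rows and
columns of variables of smaller rank. -/
def rowRank (rank : V → ℕ) : HornRow V D → ℕ
  | .var v => 2 * rank v
  | _ => 0

/-- The rank of a column; see `rowRank`. -/
def colRank (rank : V → ℕ) : HornCol V D → ℕ
  | .var v => 2 * rank v + 1
  | _ => 0

@[simp] theorem var_mem_keptRows {T : Set V} {v : V} :
    (HornRow.var v : HornRow V D) ∈ keptRows D T ↔ v ∉ T := Iff.rfl
@[simp] theorem clause_mem_keptRows {T : Set V} {d : D} :
    (HornRow.clause d : HornRow V D) ∈ keptRows D T := trivial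
@[simp] theorem anchor_mem_keptRows {T : Set V} {s : Bool} :
    (HornRow.anchor s : HornRow V D) ∈ keptRows D T := trivial
@[simp] theorem var_mem_keptCols {T : Set V} {v : V} :
    (HornCol.var v : HornCol V D) ∈ keptCols D T ↔ v ∉ T := Iff.rfl
@[simp] theorem head_mem_keptCols {T : Set V} {v : V} :
    (HornCol.head v : HornCol V D) ∈ keptCols D T := trivial
@[simp] theorem clause_mem_keptCols {T : Set V} {d : D} :
    (HornCol.clause d : HornCol V D) ∈ keptCols D T := trivial
@[simp] theorem anchor_mem_keptCols {T : Set V} {s : Bool} :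
    (HornCol.anchor s : HornCol V D) ∈ keptCols D T := trivial

theorem payoff_head_pos (T : Set V) (hT : ∀ v ∈ T, ∃ d, H.head d = v) (u : V) :
    ∃ i ∈ keptRows D T, H.payoff i (.head u) = 1 ∧ (∀ s, H.payoff i (.anchor s) = 0) ∧
      ∀ u', u' ≠ u → H.payoff i (.head u') = 0 := by
  by_cases hu : u ∈ T
  · obtain ⟨d, hd⟩ := hT u hu
    exact ⟨.clause d, by simp, by simp [payoff, hd], fun s => rfl,
      fun u' h => by simp [payoff, hd, h]⟩
  · exact ⟨.var u, by simpa using hu, by simp [payoff], fun s => rfl,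
      fun u' h => by simp [payoff, h]⟩

/-- If `T` is the least set of variables closed under the clauses, then iterated elimination
removes exactly the rows and the columns of the variables in `T`. -/
theorem certificate (T : Set V) (rank : V → ℕ)
    (hclosed : ∀ d, H.body d ⊆ T → H.head d ∈ T)
    (hsupp : ∀ v ∈ T, ∃ d, H.head d = v ∧ ∀ u ∈ H.body d, u ∈ T ∧ rank u < rank v)
    (hself : ∀ d, H.head d ∉ H.body d) :
    Certificate H.payoff (keptRows D T) (keptCols D T) (rowRank rank) (colRank rank) where
  row_safe := by
    intro i hi i₀ hne
    cases i with
    | var v =>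
      rw [var_mem_keptRows] at hi
      cases i₀ with
      | var v' =>
        have : v ≠ v' := fun e => hne (by rw [e])
        exact ⟨.head v, by simp, by simp [payoff, this]⟩
      | clause d =>
        by_cases hd : v = H.head d
        · obtain ⟨u, hu, huT⟩ := Set.not_subset.1 fun h => hi (hd ▸ hclosed d h)
          have : u ≠ v := fun e => hself d (by rw [← hd, ← e]; exact hu)
          exact ⟨.var u, by simpa using huT, by simp [payoff, this, hu]⟩
        · exact ⟨.head v, by simp, by simp [payoff, hd]⟩
      | anchor s => exact ⟨.head v, by simp, by cases s <;> simp [payoff]⟩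
    | clause d =>
      refine ⟨.clause d, by simp, ?_⟩
      cases i₀ with
      | var v' => simp [payoff]
      | clause d' =>
        have : d ≠ d' := fun e => hne (by rw [e])
        simp [payoff, this]
      | anchor s => cases s <;> simp [payoff]
    | anchor s =>
      refine ⟨.anchor s, by simp, ?_⟩
      cases i₀ with
      | var v' => simp [payoff]
      | clause d => simp [payoff]
      | anchor s' =>
        have : s ≠ s' := fun e => hne (by rw [e])
        simp [payoff, this]
  col_safe := by
    intro j hj j₀ hne
    cases j with
    | var v =>
      rw [var_mem_keptCols] at hj
      refine ⟨.var v, by simpa using hj, ?_⟩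
      cases j₀ with
      | var u =>
        have : u ≠ v := fun e => hne (by rw [e])
        simp [payoff, this]
      | head u => by_cases h : u = v <;> simp [payoff, h]
      | clause d => simp [payoff]
      | anchor s => simp [payoff]
    | head u =>
      cases j₀ with
      | var v => exact ⟨.anchor false, by simp, by simp [payoff]⟩
      | head u' =>
        have : u ≠ u' := fun e => hne (by rw [e])
        obtain ⟨i, hi, h1, -, h2⟩ := H.payoff_head_pos T
          (fun v hv => (hsupp v hv).imp fun _ h => h.1) u'
        exact ⟨i, hi, by rw [h1, h2 u this]; exact zero_lt_one⟩
      | clause d => exact ⟨.anchor false, by simp, by simp [payoff]⟩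
      | anchor s => exact ⟨.anchor s, by simp, by cases s <;> simp [payoff]⟩
    | clause d =>
      cases j₀ with
      | var v => exact ⟨.anchor true, by simp, by simp [payoff]⟩
      | head u => exact ⟨.anchor true, by simp, by simp [payoff]⟩
      | clause d' =>
        have : d ≠ d' := fun e => hne (by rw [e])
        exact ⟨.clause d', by simp, by simp [payoff, this]⟩
      | anchor s => exact ⟨.anchor s, by simp, by cases s <;> simp [payoff]⟩
    | anchor s =>
      cases j₀ with
      | var v => exact ⟨.anchor !s, by simp, by cases s <;> simp [payoff]⟩
      | head u =>
        obtain ⟨i, hi, h1, h2, -⟩ := H.payoff_head_pos T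
          (fun v hv => (hsupp v hv).imp fun _ h => h.1) u
        exact ⟨i, hi, by rw [h1, h2]; exact zero_lt_one⟩
      | clause d => exact ⟨.clause d, by simp, by simp [payoff]⟩
      | anchor s' =>
        have : s ≠ s' := fun e => hne (by rw [e])
        exact ⟨.anchor s', by simp, by simp [payoff, this]⟩
  row_elim := by
    intro i hi
    cases i with
    | var v =>
      rw [var_mem_keptRows, not_not] at hi
      obtain ⟨d, hd, hb⟩ := hsupp v hi
      refine ⟨.clause d, by simp, ⟨.clause d, by simp, by simp [payoff]⟩, fun j hj => ?_⟩
      cases j with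
      | var u =>
        have hu : u ∈ H.body d := by
          by_contra h
          simp only [payoff, if_neg h] at hj
          split_ifs at hj <;> omega
        obtain ⟨h1, h2⟩ := hb u hu
        refine ⟨by simpa using h1, ?_⟩
        simp only [colRank, rowRank]
        omega
      | head u =>
        subst hd
        exact absurd hj (lt_irrefl _)
      | clause d' =>
        simp only [payoff] at hj
        split_ifs at hj <;> omega
      | anchor s => simp [payoff] at hj
    | clause d => simp at hi
    | anchor s => simp at hi
  col_elim := by
    intro j hj
    cases j with
    | var u =>
      rw [var_mem_keptCols, not_not] at hj
      refine ⟨.anchor false, by simp, ⟨.anchor true, by simp, by simp [payoff]⟩, fun i hi => ?_⟩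
      cases i with
      | var v =>
        have : u = v := by
          by_contra h
          simp [payoff, h] at hi
        subst this
        exact ⟨by simpa using hj, by simp [colRank, rowRank]⟩
      | clause d =>
        simp only [payoff] at hi
        split_ifs at hi <;> omega
      | anchor s =>
        simp only [payoff] at hi
        split_ifs at hi <;> omega
    | head u => simp at hj
    | clause d => simp at hj
    | anchor s => simp at hj

end HornSystem

/-! ### Machines on a ring of cells -/

/-- A Turing machine whose tape is a ring that moves under a fixed head at cell `0`. If `α` is the
content of cell `0`, then in the next step every cell receives the content of its neighbour in
direction `move α`. The new content of the cell is `next α β z`, where `β` is the content received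
and `z` tells whether the cell is cell `0`. Initially the content of cell `q` depends on the symbol
of the input tape at position `q + 1`, where the `q`-th letter of the input stands. A computation
succeeds if it reaches the content `flag`. -/
structure RingMachine where
  Sig : Type
  move : Sig → Move
  next : Sig → Sig → Bool → Sig
  start : InputSym → Sig
  flag : Sig

/-- The neighbour of a cell on a ring. -/
def Move.onRing {N : ℕ} [NeZero N] : Move → Fin N → Fin N
  | .left, q => q - 1
  | .stay, q => q
  | .right, q => q + 1

namespace RingMachine

variable (R : RingMachine) (x : List Bool) {N : ℕ} [NeZero N]

/-- The content of the cells of a ring of length `N` after a number of steps. -/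
def content (N : ℕ) [NeZero N] : ℕ → Fin N → R.Sig
  | 0, q => R.start (readInput x (q + 1))
  | t + 1, q => R.next (content N t 0) (content N t ((R.move (content N t 0)).onRing q))
      (decide (q = 0))

/-- The Horn system that derives the contents of the cells in the first `N` configurations. The
variable `(q, τ, σ)` says that cell `q` has content `σ` when `τ` steps are left, so that `τ` is the
last element of `Fin N` at the start of the computation. The clause `(q, τ, α, β)` derives the
content of cell `q`, provided that before the step the content under the head was `α` and the
content of the cell that moves to `q` was `β`. -/
def horn (N : ℕ) [NeZero N] :
    HornSystem (Fin N × Fin N × R.Sig) (Fin N × Fin N × R.Sig × R.Sig) where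
  head := fun ⟨q, τ, α, β⟩ => (q, τ,
    if τ + 1 = 0 then R.start (readInput x (q + 1)) else R.next α β (decide (q = 0)))
  body := fun ⟨q, τ, α, β⟩ => {u | τ + 1 ≠ 0 ∧ u.2.1 = τ + 1 ∧
    (u.1 = 0 ∧ u.2.2 = α ∨ u.1 = (R.move α).onRing q ∧ u.2.2 = β)}

theorem succ_eq_zero_iff (τ : Fin N) : τ + 1 = 0 ↔ τ.val = N - 1 := by
  obtain ⟨M, rfl⟩ : ∃ M, N = M + 1 := ⟨N - 1, by have := NeZero.pos N; omega⟩
  rw [← Fin.last_add_one M, add_left_inj, Fin.ext_iff]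
  simp

theorem val_succ_of_ne {τ : Fin N} (h : τ + 1 ≠ 0) : (τ + 1).val = τ.val + 1 := by
  obtain ⟨M, rfl⟩ : ∃ M, N = M + 1 := ⟨N - 1, by have := NeZero.pos N; omega⟩
  rw [Fin.val_add_one, if_neg]
  rintro rfl
  exact h (Fin.last_add_one M)

/-- The variables that hold in the computation. -/
def valid (N : ℕ) [NeZero N] : Set (Fin N × Fin N × R.Sig) :=
  {u | u.2.2 = R.content x N (N - 1 - u.2.1) u.1}

theorem horn_certificate (N : ℕ) [NeZero N] :
    Certificate (R.horn x N).payoff (HornSystem.keptRows _ (R.valid x N))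
      (HornSystem.keptCols _ (R.valid x N)) (HornSystem.rowRank fun u => N - 1 - u.2.1)
      (HornSystem.colRank fun u => N - 1 - u.2.1) := by
  have hstep : ∀ τ : Fin N, τ + 1 ≠ 0 → N - 1 - τ.val = N - 1 - (τ + 1).val + 1 := by
    intro τ h
    have h1 := (τ + 1).isLt
    rw [val_succ_of_ne h] at h1 ⊢
    omega
  apply HornSystem.certificate
  · rintro ⟨q, τ, α, β⟩ hb
    by_cases hτ : τ + 1 = 0
    · have := (succ_eq_zero_iff τ).1 hτ
      simp [horn, valid, hτ, this, content]
    · have h1 : ((0, τ + 1, α) : Fin N × Fin N × R.Sig) ∈ R.valid x N :=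
        hb ⟨hτ, rfl, Or.inl ⟨rfl, rfl⟩⟩
      have h2 : (((R.move α).onRing q, τ + 1, β) : Fin N × Fin N × R.Sig) ∈ R.valid x N :=
        hb ⟨hτ, rfl, Or.inr ⟨rfl, rfl⟩⟩
      simp only [valid, Set.mem_ofPred_eq] at h1 h2
      simp only [horn, valid, Set.mem_ofPred_eq, if_neg hτ]
      rw [hstep τ hτ, content, ← h1, ← h2]
  · rintro ⟨q, τ, σ⟩ hv
    simp only [valid, Set.mem_ofPred_eq] at hv
    by_cases hτ : τ + 1 = 0
    · have h1 := (succ_eq_zero_iff τ).1 hτ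
      refine ⟨(q, τ, σ, σ), ?_, fun u hu => absurd hτ hu.1⟩
      simp [horn, hτ, hv, h1, content]
    · refine ⟨(q, τ, R.content x N (N - 1 - (τ + 1).val) 0, R.content x N (N - 1 - (τ + 1).val)
        ((R.move (R.content x N (N - 1 - (τ + 1).val) 0)).onRing q)), ?_, ?_⟩
      · simp only [horn, if_neg hτ]
        rw [hv, hstep τ hτ, content]
      · rintro ⟨q', τ', σ'⟩ ⟨-, h2, h3⟩
        dsimp only at h2 h3 ⊢
        subst h2
        refine ⟨?_, by have := hstep τ hτ; omega⟩
        simp only [valid, Set.mem_ofPred_eq]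
        rcases h3 with ⟨rfl, h⟩ | ⟨rfl, h⟩ <;> exact h
  · rintro ⟨q, τ, α, β⟩ ⟨h1, h2, -⟩
    simp only [horn] at h2
    have := val_succ_of_ne h1
    rw [← h2] at this
    omega

end RingMachine

/-! ### The game of a ring machine -/

namespace RingMachine

variable (R : RingMachine) (x : List Bool) {N : ℕ} [NeZero N] (sigs : List R.Sig)

/-- The rows that belong to a cell and a time, without these two. -/
abbrev RowTag := HornRow R.Sig (R.Sig × R.Sig)

/-- The columns that belong to a cell and a time, without these two. -/
abbrev ColTag := HornCol R.Sig (R.Sig × R.Sig)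

/-- The row with a given cell, time and tag. -/
def rowAt (q τ : Fin N) :
    R.RowTag → HornRow (Fin N × Fin N × R.Sig) (Fin N × Fin N × R.Sig × R.Sig)
  | .var σ => .var (q, τ, σ)
  | .clause d => .clause (q, τ, d)
  | .anchor s => .anchor s

/-- The column with a given cell, time and tag. -/
def colAt (q τ : Fin N) :
    R.ColTag → HornCol (Fin N × Fin N × R.Sig) (Fin N × Fin N × R.Sig × R.Sig)
  | .var σ => .var (q, τ, σ)
  | .head σ => .head (q, τ, σ)
  | .clause d => .clause (q, τ, d)
  | .anchor s => .anchor s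

variable {R}

/-- The tags of the rows that belong to a cell and a time, starting with the variable of the
first content listed. -/
def rowTags : List R.RowTag := sigs.map .var ++ (sigs ×ˢ sigs).map .clause

/-- The tags of the columns that belong to a cell and a time. -/
def colTags : List R.ColTag := sigs.map .var ++ (sigs.map .head ++ (sigs ×ˢ sigs).map .clause)

/-- All rows of the game, in the order in which they are written down. -/
def rowList (N : ℕ) [NeZero N] :
    List (HornRow (Fin N × Fin N × R.Sig) (Fin N × Fin N × R.Sig × R.Sig)) :=
  ((List.finRange N).flatMap fun q => (List.finRange N).flatMap fun τ =>
    (rowTags sigs).map (R.rowAt q τ)) ++ [.anchor false, .anchor true]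

/-- All columns of the game, in the order in which they are written down. -/
def colList (N : ℕ) [NeZero N] :
    List (HornCol (Fin N × Fin N × R.Sig) (Fin N × Fin N × R.Sig × R.Sig)) :=
  ((List.finRange N).flatMap fun q => (List.finRange N).flatMap fun τ =>
    (colTags sigs).map (R.colAt q τ)) ++ [.anchor false, .anchor true]

variable {sigs}

theorem mem_rowTags (hs : ∀ σ, σ ∈ sigs) (r : R.RowTag) :
    r ∈ rowTags sigs ↔ ∀ s, r ≠ .anchor s := by
  rcases r with σ | ⟨α, β⟩ | s <;> simp [rowTags, hs]

theorem mem_colTags (hs : ∀ σ, σ ∈ sigs) (c : R.ColTag) :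
    c ∈ colTags sigs ↔ ∀ s, c ≠ .anchor s := by
  rcases c with σ | σ | ⟨α, β⟩ | s <;> simp [colTags, hs]

theorem nodup_rowTags (hn : sigs.Nodup) : (rowTags sigs).Nodup := by
  refine List.Nodup.append (hn.map fun a b h => by cases h; rfl)
    ((hn.product hn).map fun a b h => by cases h; rfl) ?_
  intro r h1 h2
  obtain ⟨σ, -, rfl⟩ := List.mem_map.1 h1
  simp at h2

theorem nodup_colTags (hn : sigs.Nodup) : (colTags sigs).Nodup := by
  refine List.Nodup.append (hn.map fun a b h => by cases h; rfl)
    (List.Nodup.append (hn.map fun a b h => by cases h; rfl)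
    ((hn.product hn).map fun a b h => by cases h; rfl) ?_) ?_
  · intro r h1 h2
    obtain ⟨σ, -, rfl⟩ := List.mem_map.1 h1
    simp at h2
  · intro r h1 h2
    obtain ⟨σ, -, rfl⟩ := List.mem_map.1 h1
    simp at h2

theorem mem_rowList (hs : ∀ σ, σ ∈ sigs)
    (r : HornRow (Fin N × Fin N × R.Sig) (Fin N × Fin N × R.Sig × R.Sig)) :
    r ∈ rowList (R := R) sigs N := by
  simp only [rowList, List.mem_append, List.mem_flatMap, List.mem_finRange, true_and, List.mem_map]
  cases r with
  | var v => exact Or.inl ⟨v.1, v.2.1, .var v.2.2, (mem_rowTags hs _).2 (by simp), rfl⟩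
  | clause d => exact Or.inl ⟨d.1, d.2.1, .clause d.2.2, (mem_rowTags hs _).2 (by simp), rfl⟩
  | anchor s => cases s <;> simp

theorem mem_colList (hs : ∀ σ, σ ∈ sigs)
    (c : HornCol (Fin N × Fin N × R.Sig) (Fin N × Fin N × R.Sig × R.Sig)) :
    c ∈ colList (R := R) sigs N := by
  simp only [colList, List.mem_append, List.mem_flatMap, List.mem_finRange, true_and, List.mem_map]
  cases c with
  | var v => exact Or.inl ⟨v.1, v.2.1, .var v.2.2, (mem_colTags hs _).2 (by simp), rfl⟩
  | head v => exact Or.inl ⟨v.1, v.2.1, .head v.2.2, (mem_colTags hs _).2 (by simp), rfl⟩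
  | clause d => exact Or.inl ⟨d.1, d.2.1, .clause d.2.2, (mem_colTags hs _).2 (by simp), rfl⟩
  | anchor s => cases s <;> simp

omit [NeZero N] in
theorem rowAt_inj {q τ q' τ' : Fin N} {r r' : R.RowTag} (h : ∀ s, r ≠ .anchor s)
    (e : R.rowAt q τ r = R.rowAt q' τ' r') : q = q' ∧ τ = τ' ∧ r = r' := by
  cases r <;> cases r' <;> simp_all [rowAt]

omit [NeZero N] in
theorem colAt_inj {q τ q' τ' : Fin N} {r r' : R.ColTag} (h : ∀ s, r ≠ .anchor s)
    (e : R.colAt q τ r = R.colAt q' τ' r') : q = q' ∧ τ = τ' ∧ r = r' := by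
  cases r <;> cases r' <;> simp_all [colAt]

/-- A list that runs through two coordinates and a tag has no duplicates. -/
theorem nodup_flatMap_flatMap {α β τ : Type*} (l : List α) (t : List τ) (f : α → α → τ → β)
    (hl : l.Nodup) (ht : t.Nodup) (hf : ∀ a b c a' b' c', c ∈ t → c' ∈ t →
      f a b c = f a' b' c' → a = a' ∧ b = b' ∧ c = c') :
    (l.flatMap fun a => l.flatMap fun b => t.map (f a b)).Nodup := by
  have h := (hl.product (hl.product ht)).map_on (f := fun p => f p.1 p.2.1 p.2.2) (by
    rintro ⟨a, b, c⟩ h ⟨a', b', c'⟩ h' e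
    obtain ⟨rfl, rfl, rfl⟩ := hf a b c a' b' c' (by simp_all) (by simp_all) e
    rfl)
  simpa [SProd.sprod, List.product, List.map_flatMap, List.map_map, Function.comp_def] using h

theorem nodup_rowList (hn : sigs.Nodup) (hs : ∀ σ, σ ∈ sigs) :
    (rowList (R := R) sigs N).Nodup := by
  refine List.Nodup.append (nodup_flatMap_flatMap _ _ _ (List.nodup_finRange N) (nodup_rowTags hn)
    fun a b c a' b' c' h _ e => rowAt_inj ((mem_rowTags hs c).1 h) e) (by simp) ?_
  intro r h1 h2
  simp only [List.mem_flatMap, List.mem_map] at h1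
  obtain ⟨q, -, τ, -, c, hc, rfl⟩ := h1
  cases c <;> simp [rowAt] at h2
  exact (mem_rowTags hs _).1 hc _ rfl

theorem nodup_colList (hn : sigs.Nodup) (hs : ∀ σ, σ ∈ sigs) :
    (colList (R := R) sigs N).Nodup := by
  refine List.Nodup.append (nodup_flatMap_flatMap _ _ _ (List.nodup_finRange N) (nodup_colTags hn)
    fun a b c a' b' c' h _ e => colAt_inj ((mem_colTags hs c).1 h) e) (by simp) ?_
  intro r h1 h2
  simp only [List.mem_flatMap, List.mem_map] at h1
  obtain ⟨q, -, τ, -, c, hc, rfl⟩ := h1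
  cases c <;> simp [colAt] at h2
  exact (mem_colTags hs _).1 hc _ rfl

variable (sigs R)

/-- The zero-sum game of the Horn system of a ring machine.  The designated row is the first one. -/
noncomputable def game (N : ℕ) [NeZero N] : GameInstance where
  n := (rowList (R := R) sigs N).length
  m := (colList (R := R) sigs N).length
  m_pos := by simp [colList]
  A i j := (R.horn x N).payoff ((rowList sigs N).get i) ((colList sigs N).get j)
  B i j := -(R.horn x N).payoff ((rowList sigs N).get i) ((colList sigs N).get j)
  i := ⟨0, by simp [rowList]⟩

theorem game_zeroSum : (R.game x sigs N).ZeroSum := fun i j => by simp [game]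

theorem game_atMostValues : (R.game x sigs N).AtMostValues 3 := by
  have : {v : ℤ | ∃ i j, (R.game x sigs N).A i j = v ∨ (R.game x sigs N).B i j = v} ⊆
      (({-1, 0, 1} : Finset ℤ) : Set ℤ) := by
    rintro v ⟨i, j, h⟩
    have := (R.horn x N).payoff_mem ((rowList sigs N).get i) ((colList sigs N).get j)
    simp only [game] at h
    simp only [Finset.coe_insert, Finset.coe_singleton, Set.mem_insert_iff, Set.mem_singleton_iff]
    omega
  refine (Set.ncard_le_ncard this (Finset.finite_toSet _)).trans ?_
  rw [Set.ncard_coe_finset]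
  decide

variable {R sigs}

/-- The elimination certificate of the game, and the fate of the designated row. -/
theorem exists_game_certificate (hn : sigs.Nodup) (hs : ∀ σ, σ ∈ sigs)
    (hh : sigs.head? = some R.flag) :
    ∃ (S : Set (Fin (R.game x sigs N).n)) (C : Set (Fin (R.game x sigs N).m))
      (rr : Fin (R.game x sigs N).n → ℕ) (rc : Fin (R.game x sigs N).m → ℕ),
      Certificate (R.game x sigs N).A S C rr rc ∧
      ((R.game x sigs N).i ∉ S ↔ R.content x N (N - 1) 0 = R.flag) := by
  have hb1 : Function.Bijective (rowList (R := R) sigs N).get :=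
    ⟨List.nodup_iff_injective_get.1 (nodup_rowList hn hs), fun r => by
      simpa [List.mem_iff_get] using mem_rowList hs r⟩
  have hb2 : Function.Bijective (colList (R := R) sigs N).get :=
    ⟨List.nodup_iff_injective_get.1 (nodup_colList hn hs), fun c => by
      simpa [List.mem_iff_get] using mem_colList hs c⟩
  refine ⟨_, _, _, _, (R.horn_certificate x N).comap hb1 hb2, ?_⟩
  obtain ⟨M, rfl⟩ : ∃ M, N = M + 1 := ⟨N - 1, by have := NeZero.pos N; omega⟩
  have h0 : (rowList (R := R) sigs (M + 1)).get (R.game x sigs (M + 1)).i =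
      .var (0, 0, R.flag) := by
    obtain ⟨l, rfl⟩ : ∃ l, sigs = R.flag :: l := by
      cases sigs with
      | nil => simp at hh
      | cons a l => exact ⟨l, by simp at hh; rw [hh]⟩
    simp [game, rowList, List.finRange_succ, rowTags, rowAt]
  refine (not_congr (show _ ↔ (rowList sigs (M + 1)).get (R.game x sigs (M + 1)).i ∈
    HornSystem.keptRows _ (R.valid x (M + 1)) from Iff.rfl)).trans ?_
  rw [h0, HornSystem.var_mem_keptRows, not_not]
  simp only [valid, Set.mem_ofPred_eq]
  exact eq_comm

/-- The word that describes the game. -/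
theorem encode_game : (R.game x sigs N).encode =
    GameSym.newline :: (rowList (R := R) sigs N).flatMap fun r =>
      ((colList sigs N).flatMap fun c =>
        encodeEntry ((R.horn x N).payoff r c, -(R.horn x N).payoff r c)) ++ [GameSym.newline] := by
  have key : ∀ {X Y Z W : Type} (l : List X) (k : List Y) (f : X → Y → Z) (g : List Z → List W),
      (List.ofFn fun i => List.ofFn fun j => f (l.get i) (k.get j)).flatMap g =
        l.flatMap fun r => g (k.map (f r)) := by
    intro X Y Z W l k f g
    have h1 : ∀ r, (List.ofFn fun j => f r (k.get j)) = k.map (f r) := fun r => by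
      conv_rhs => rw [← List.ofFn_get k, List.map_ofFn]
      rfl
    simp only [h1]
    conv_rhs => rw [← List.ofFn_get l]
    rw [List.flatMap_def, List.flatMap_def, List.map_ofFn, List.map_ofFn]
    rfl
  unfold GameInstance.encode
  change encodeNat 0 ++ _ = _
  rw [show encodeNat 0 = [] by simp [encodeNat], List.nil_append]
  congr 1
  refine (key (rowList (R := R) sigs N) (colList sigs N)
    (fun r c => ((R.horn x N).payoff r c, -(R.horn x N).payoff r c)) _).trans ?_
  simp only [encodeRow, List.flatMap_map]

end RingMachine

/-! ### Simulation of a Turing machine on a ring -/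

section TuringMachine

open Turing

variable {Γ Λ : Type} [Inhabited Γ] [Inhabited Λ] (M : TM0.Machine Γ Λ) (acc : Set Λ)

open Classical in
/-- A step of a Turing machine in which halting rejecting configurations are repeated and halting
accepting configurations are followed by `none`. -/
noncomputable def stepOrFlag (o : Option (TM0.Cfg Γ Λ)) : Option (TM0.Cfg Γ Λ) :=
  o.bind fun c => match TM0.step M c with
    | some c' => some c'
    | none => if c.q ∈ acc then none else some c

theorem stepOrFlag_iterate_none (k : ℕ) : (stepOrFlag M acc)^[k] none = none :=
  Function.iterate_fixed rfl k

/-- The computation with `stepOrFlag` agrees with that of the machine until this halts. -/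
theorem stepOrFlag_iterate_of_evalsTo {a : TM0.Cfg Γ Λ} : ∀ (k : ℕ) (c : TM0.Cfg Γ Λ),
    (flip bind (TM0.step M))^[k] (some a) = some c → (stepOrFlag M acc)^[k] (some a) = some c
  | 0, c, h => h
  | k + 1, c, h => by
    rw [Function.iterate_succ_apply'] at h ⊢
    obtain ⟨c', h1, h2⟩ := Option.bind_eq_some_iff.1 h
    rw [stepOrFlag_iterate_of_evalsTo k c' h1]
    simp [stepOrFlag, h2]

theorem stepOrFlag_iterate_of_halt {c : TM0.Cfg Γ Λ} (h : TM0.step M c = none) (k : ℕ) :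
    (stepOrFlag M acc)^[k] (some c) = some c ∨ (stepOrFlag M acc)^[k] (some c) = none := by
  induction k with
  | zero => exact Or.inl rfl
  | succ k ih =>
    rw [Function.iterate_succ_apply']
    rcases ih with ih | ih <;> rw [ih]
    · by_cases ha : c.q ∈ acc <;> simp [stepOrFlag, h, ha]
    · exact Or.inr rfl

theorem stepOrFlag_iterate_eq_none {c : TM0.Cfg Γ Λ} (h : TM0.step M c = none) {k : ℕ}
    (hk : 0 < k) : (stepOrFlag M acc)^[k] (some c) = none ↔ c.q ∈ acc := by
  by_cases ha : c.q ∈ acc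
  · obtain ⟨j, rfl⟩ : ∃ j, k = j + 1 := ⟨k - 1, by omega⟩
    rw [Function.iterate_succ_apply]
    simp [stepOrFlag, h, ha, stepOrFlag_iterate_none]
  · have : stepOrFlag M acc (some c) = some c := by simp [stepOrFlag, h, ha]
    rw [Function.iterate_fixed this]
    simp [ha]

/-- A tape is blank at all positions of absolute value at least `b`. -/
def BlankBeyond (b : ℕ) (T : Tape Γ) : Prop := ∀ z : ℤ, b ≤ z.natAbs → T.nth z = default

theorem blankBeyond_step {b : ℕ} {c c' : TM0.Cfg Γ Λ} (h : BlankBeyond b c.Tape)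
    (hs : TM0.step M c = some c') : BlankBeyond (b + 1) c'.Tape := by
  obtain ⟨q, T⟩ := c
  obtain ⟨⟨q', s⟩, -, rfl⟩ := Option.map_eq_some_iff.1 hs
  intro z hz
  rcases s with (_ | _) | w
  · rw [Tape.move_left_nth]
    exact h _ (by omega)
  · rw [Tape.move_right_nth]
    exact h _ (by omega)
  · rw [Tape.write_nth, if_neg (by omega)]
    exact h _ (by omega)

theorem blankBeyond_iterate {b : ℕ} {a : TM0.Cfg Γ Λ} (h : BlankBeyond b a.Tape) :
    ∀ (k : ℕ) (c : TM0.Cfg Γ Λ), (stepOrFlag M acc)^[k] (some a) = some c →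
      BlankBeyond (b + k) c.Tape
  | 0, c, hc => by
    cases hc
    exact h
  | k + 1, c, hc => by
    rw [Function.iterate_succ_apply'] at hc
    obtain ⟨c', h1, h2⟩ := Option.bind_eq_some_iff.1 hc
    have ih := blankBeyond_iterate h k c' h1
    rcases hs : TM0.step M c' with _ | c''
    · rw [hs] at h2
      have : c = c' := by
        dsimp only at h2
        split_ifs at h2
        exact (Option.some.inj h2).symm
      subst this
      exact fun z hz => ih z (by omega)
    · rw [hs] at h2
      cases h2
      exact blankBeyond_step M ih hs

open Classical in
/-- The ring machine that simulates a Turing machine. Every cell knows the state of the machine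
besides its own symbol; the tape moves and the head rests, as for Mathlib's tapes. The content
`none` signals that the machine has halted in an accepting state. -/
noncomputable def ringMachine (sym : Bool → Γ) : RingMachine where
  Sig := Option (Λ × Γ)
  move := fun o => match o with
    | none => .stay
    | some (s, σ) => match M s σ with
      | some (_, .move .left) => .left
      | some (_, .move .right) => .right
      | _ => .stay
  next := fun o o' z => match o, o' with
    | some (s, σ), some (_, a) => match M s σ with
      | none => if s ∈ acc then none else some (s, a)
      | some (s', .move _) => some (s', a)
      | some (s', .write w) => some (s', if z then w else a)
    | _, _ => none
  start := fun a => some (default, match a with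
    | .bit b => sym b
    | _ => default)
  flag := none

/-- The position on the two-way infinite tape of a cell of a ring of length `2 * H`. -/
def tapePos {H : ℕ} (q : Fin (2 * H)) : ℤ := if q.val < H then q.val else q.val - 2 * H

/-- The neighbour of a cell on a ring is its neighbour on the tape, except for cells in the blank
part of the tape. -/
theorem nth_tapePos_onRing {H b : ℕ} [NeZero (2 * H)] {T : Tape Γ} (hT : BlankBeyond b T)
    (hb : b < H) (q : Fin (2 * H)) (d : Move) :
    T.nth (tapePos (d.onRing q)) = T.nth (d.onWork (tapePos q)) := by
  have hq := q.isLt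
  cases d with
  | stay => rfl
  | left =>
    simp only [Move.onRing, Move.onWork]
    have h1 : (q - 1).val = if q.val = 0 then 2 * H - 1 else q.val - 1 := by
      rw [Fin.val_sub, Fin.val_one', Nat.mod_eq_of_lt (show 1 < 2 * H by omega)]
      split_ifs with h
      · rw [h, Nat.add_zero, Nat.mod_eq_of_lt (by omega)]
      · rw [show 2 * H - 1 + q.val = q.val - 1 + 2 * H by omega, Nat.add_mod_right,
          Nat.mod_eq_of_lt (by omega)]
    unfold tapePos
    rw [h1]
    split_ifs <;> first
      | (exfalso; omega)
      | (exact congrArg _ (by omega))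
      | (rw [hT _ (by omega), hT _ (by omega)])
  | right =>
    simp only [Move.onRing, Move.onWork]
    have h1 : (q + 1).val = if q.val + 1 = 2 * H then 0 else q.val + 1 := by
      rw [Fin.val_add, Fin.val_one', Nat.mod_eq_of_lt (show 1 < 2 * H by omega)]
      split_ifs with h
      · rw [h, Nat.mod_self]
      · exact Nat.mod_eq_of_lt (by omega)
    unfold tapePos
    by_cases h2 : q.val + 1 = 2 * H
    · rw [if_pos h2] at h1
      rw [h1, if_pos (by omega), if_neg (by omega)]
      congr 1
      omega
    · rw [if_neg h2] at h1
      rw [h1]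
      split_ifs <;> first
        | (exfalso; omega)
        | (exact congrArg _ (by omega))
        | (rw [hT _ (by omega), hT _ (by omega)])

theorem nth_mk₁ (l : List Γ) (z : ℤ) :
    (Tape.mk₁ l).nth z = if z < 0 then default else l.getI z.toNat := by
  unfold Tape.mk₁ Tape.mk₂
  rcases z with (_ | k) | k
  · cases l <;> simp [Tape.nth, Tape.mk']
  · have : ¬ ((k : ℤ) + 1 < 0) := by omega
    cases l <;> simp [Tape.nth, Tape.mk', this]
  · simp [Tape.nth, Tape.mk']

/-- As long as the machine uses less than half of the ring, the contents of the cells of the ring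
describe its configuration. -/
theorem content_ringMachine (sym : Bool → Γ) (x : List Bool) {H b : ℕ} [NeZero (2 * H)]
    (hb : b < H) (hx : x.length < H)
    (hblank : ∀ k c, (stepOrFlag M acc)^[k] (some (TM0.init (x.map sym))) = some c →
      BlankBeyond b c.Tape) (t : ℕ) (q : Fin (2 * H)) :
    (ringMachine M acc sym).content x (2 * H) t q =
      ((stepOrFlag M acc)^[t] (some (TM0.init (x.map sym)))).map
        fun c => (c.q, c.Tape.nth (tapePos q)) := by
  induction t generalizing q with
  | zero =>
    simp only [RingMachine.content, ringMachine, Function.iterate_zero, id_eq, Option.map_some,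
      TM0.init]
    congr 2
    rw [nth_mk₁]
    unfold tapePos
    split_ifs with h1 h2 h2
    · omega
    · simp only [readInput, Int.toNat_natCast]
      rcases lt_or_ge q.val x.length with h | h
      · rw [List.getElem?_eq_getElem h, List.getI_eq_getElem _ (by simpa using h)]
        simp
      · rw [List.getElem?_eq_none h, List.getI_eq_default _ (by simpa using h)]
    · simp only [readInput]
      rw [List.getElem?_eq_none (by omega)]
    · omega
  | succ t ih =>
    have h0 : tapePos (0 : Fin (2 * H)) = 0 := by
      unfold tapePos
      rw [if_pos] <;> simp
      omega
    have hq0 : tapePos q = 0 ↔ q = 0 := by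
      rw [Fin.ext_iff, Fin.val_zero]
      unfold tapePos
      split_ifs <;> omega
    rw [RingMachine.content, ih, ih, h0, Function.iterate_succ_apply']
    rcases ho : (stepOrFlag M acc)^[t] (some (TM0.init (x.map sym))) with _ | c
    · simp [ringMachine, stepOrFlag]
    · have hbc := hblank t c ho
      simp only [Option.map_some, stepOrFlag, Option.bind_some]
      rw [nth_tapePos_onRing hbc hb]
      obtain ⟨s, T⟩ := c
      simp only [ringMachine, TM0.step, Tape.nth_zero]
      rcases hM : M s T.head with _ | ⟨s', (_ | _) | w⟩
      · by_cases ha : s ∈ acc <;> simp [ha, Move.onWork]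
      · simp [Move.onWork, Tape.move_left_nth]
      · simp [Move.onWork, Tape.move_right_nth]
      · by_cases hq : q = 0
        · cases T
          simp [hq, h0, Tape.write]
        · have : tapePos q ≠ 0 := fun h => hq (hq0.1 h)
          simp [Tape.write_nth, hq, this, Move.onWork]

/-- The ring machine decides whether the Turing machine accepts. -/
theorem content_ringMachine_eq_flag {sym : Bool → Γ} {x : List Bool} {c : TM0.Cfg Γ Λ}
    {T H : ℕ} [NeZero (2 * H)]
    (hc : StateTransition.EvalsToInTime (TM0.step M) (TM0.init (x.map sym)) (some c) T)
    (hhalt : TM0.step M c = none) (hH : x.length + T + 1 < H) :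
    (ringMachine M acc sym).content x (2 * H) (2 * H - 1) 0 = (ringMachine M acc sym).flag ↔
      c.q ∈ acc := by
  have hk := hc.steps_le_m
  have hrun := stepOrFlag_iterate_of_evalsTo M acc hc.steps c hc.evals_in_steps
  have hinit : BlankBeyond (x.length + 1) (TM0.init (x.map sym) : TM0.Cfg Γ Λ).Tape := by
    intro z hz
    simp only [TM0.init]
    rw [nth_mk₁]
    split_ifs with h
    · rfl
    · exact List.getI_eq_default _ (by simp; omega)
  have hblank : ∀ k c', (stepOrFlag M acc)^[k] (some (TM0.init (x.map sym))) = some c' →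
      BlankBeyond (x.length + 1 + T) c'.Tape := by
    intro k c' h
    rcases le_total k hc.steps with hle | hle
    · exact fun z hz => blankBeyond_iterate M acc hinit k c' h z (by omega)
    · have hcc : c' = c := by
        rw [show k = (k - hc.steps) + hc.steps by omega, Function.iterate_add_apply, hrun] at h
        rcases stepOrFlag_iterate_of_halt M acc hhalt (k - hc.steps) with h' | h' <;> rw [h'] at h
        · exact (Option.some.inj h).symm
        · cases h
      subst hcc
      exact fun z hz => blankBeyond_iterate M acc hinit _ c' hrun z (by omega)
  rw [content_ringMachine M acc sym x (by omega) (by omega) hblank]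
  change Option.map _ _ = none ↔ _
  rw [Option.map_eq_none_iff, show 2 * H - 1 = (2 * H - 1 - hc.steps) + hc.steps by omega,
    Function.iterate_add_apply, hrun]
  exact stepOrFlag_iterate_eq_none M acc hhalt (by omega)

end TuringMachine

/-! ### Transducers that work in sweeps -/

/-- A machine that works on a finite word. A macro step in state `s` starts a sweep in the scanning
state `load s a`, where `a` is the symbol under the input head. The sweep runs through the word
from left to right and rewrites it by `scan`. If it ends in the scanning state `c`, then the letter
`grow c` is appended to the word, and `finish c` determines the next state (`none` to halt), the
movement of the input head and the output. -/
structure Sweeper (Out : Type) where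
  S : Type
  C : Type
  G : Type
  finS : Finite S
  finC : Finite C
  finG : Finite G
  start : S
  load : S → InputSym → C
  scan : C → G → C × G
  grow : C → Option G
  finish : C → Option S × Move × List Out

namespace Sweeper

variable {Out : Type} (P : Sweeper Out)

/-- The configurations between two sweeps. -/
structure Cfg where
  state : P.S
  inputHead : ℕ
  word : List P.G
  output : List Out

/-- The result of a sweep over a word. -/
def sweep : P.C → List P.G → P.C × List P.G
  | c, [] => (c, (P.grow c).toList)
  | c, g :: w => ((sweep (P.scan c g).1 w).1, (P.scan c g).2 :: (sweep (P.scan c g).1 w).2)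

variable {P} in
theorem sweep_cons_of_scan {c c' : P.C} {g g' : P.G} (h : P.scan c g = (c', g')) (w : List P.G) :
    P.sweep c (g :: w) = ((P.sweep c' w).1, g' :: (P.sweep c' w).2) := by
  rw [sweep, h]

/-- The result of the sweep in a configuration. -/
def sweepOf (x : List Bool) (e : P.Cfg) : P.C × List P.G :=
  P.sweep (P.load e.state (readInput x e.inputHead)) e.word

/-- A macro step from one configuration to the next. -/
def Step (x : List Bool) (e e' : P.Cfg) : Prop :=
  ∃ s, (P.finish (P.sweepOf x e).1).1 = some s ∧
    e' = { state := s
           inputHead := (P.finish (P.sweepOf x e).1).2.1.onInput x.length e.inputHead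
           word := (P.sweepOf x e).2
           output := e.output ++ (P.finish (P.sweepOf x e).1).2.2 }

/-- The next macro step is the last one, and it completes the output to `y`. -/
def Halts (x : List Bool) (e : P.Cfg) (y : List Out) : Prop :=
  (P.finish (P.sweepOf x e).1).1 = none ∧ y = e.output ++ (P.finish (P.sweepOf x e).1).2.2

/-- The initial configuration. -/
def init : P.Cfg := ⟨P.start, 1, [], []⟩

/-- The phases of a macro step: at rest, sweeping to the right, returning to the left end, and
writing the rest of an output word. -/
inductive Phase (S C W : Type)
  | idle (s : S)
  | right (c : C)
  | back (c : C)
  | emit (c : C) (l : W)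

instance {S C W : Type} [Finite S] [Finite C] [Finite W] : Finite (Phase S C W) := by
  let f : Phase S C W → (S ⊕ C) ⊕ (C ⊕ C × W) := fun p => match p with
    | .idle s => .inl (.inl s)
    | .right c => .inl (.inr c)
    | .back c => .inr (.inl c)
    | .emit c l => .inr (.inr (c, l))
  refine Finite.of_injective f ?_
  rintro (_ | _ | _ | _) (_ | _ | _ | _) h <;> simp_all [f]

theorem exists_bound : ∃ L, ∀ c, (P.finish c).2.2.length ≤ L := by
  have := P.finC
  obtain ⟨L, hL⟩ := (Set.finite_range fun c => (P.finish c).2.2.length).bddAbove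
  exact ⟨L, fun c => hL ⟨c, rfl⟩⟩

/-- A bound for the length of the output words of single macro steps. -/
noncomputable def bound : ℕ := P.exists_bound.choose

/-- The output words that may have to be written during a macro step. -/
abbrev Pending : Type := {l : List Out // l.length ≤ P.bound}

/-- The output word of a macro step, as a pending word. -/
noncomputable def pending (c : P.C) : P.Pending :=
  ⟨(P.finish c).2.2, P.exists_bound.choose_spec c⟩

/-- The transitions of the transducer that carries out the macro steps. The word occupies the cells
of its work tape from `0` on; all other cells are blank. -/
noncomputable def delta : Phase P.S P.C P.Pending → InputSym → Option P.G →
    Option (Action (Phase P.S P.C P.Pending) (Option P.G) Out 1)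
  | .idle s, a, g => some ⟨.right (P.load s a), .stay, fun _ => g, fun _ => .stay, none⟩
  | .right c, _, some g =>
      some ⟨.right (P.scan c g).1, .stay, fun _ => some (P.scan c g).2, fun _ => .right, none⟩
  | .right c, _, none => some ⟨.back c, .stay, fun _ => P.grow c, fun _ => .left, none⟩
  | .back c, _, some g => some ⟨.back c, .stay, fun _ => some g, fun _ => .left, none⟩
  | .back c, _, none => some ⟨.emit c (P.pending c), .stay, fun _ => none, fun _ => .right, none⟩
  | .emit c ⟨o :: l, h⟩, _, g =>
      some ⟨.emit c ⟨l, (Nat.le_succ _).trans h⟩, .stay, fun _ => g, fun _ => .stay, some o⟩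
  | .emit c ⟨[], _⟩, _, g => (P.finish c).1.map fun s =>
      ⟨.idle s, (P.finish c).2.1, fun _ => g, fun _ => .stay, none⟩

/-- The transducer with a single work tape that carries out the macro steps. -/
noncomputable def toTransducer [Finite Out] : Transducer Out where
  Q := Phase P.S P.C P.Pending
  Γ := Option P.G
  finQ := by
    have := P.finS
    have := P.finC
    have : Finite P.Pending := (List.finite_length_le Out P.bound).to_subtype
    infer_instance
  finΓ := by
    have := P.finG
    infer_instance
  k := 1
  start := .idle P.start
  blank := none
  δ q a r := P.delta q a (r 0)

variable [Finite Out]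

/-- The tape that carries a word in the cells from `0` on. -/
def tapeOf (w : List P.G) : ℤ → Option P.G := fun z => if z < 0 then none else w[z.toNat]?

/-- The configuration of the transducer with a given work tape. -/
def cfgOf (q : Phase P.S P.C P.Pending) (p : ℕ) (T : ℤ → Option P.G) (z : ℤ) (y : List Out) :
    P.toTransducer.Cfg :=
  ⟨q, p, fun _ => T, fun _ => z, y⟩

omit [Finite Out] in
theorem tapeOf_length (w : List P.G) : P.tapeOf w w.length = none := by simp [tapeOf]

omit [Finite Out] in
theorem tapeOf_append_cons (u : List P.G) (g : P.G) (w : List P.G) :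
    P.tapeOf (u ++ g :: w) u.length = some g := by simp [tapeOf]

omit [Finite Out] in
theorem update_tapeOf (u : List P.G) (g g' : P.G) (w : List P.G) :
    Function.update (P.tapeOf (u ++ g :: w)) u.length (some g') = P.tapeOf (u ++ g' :: w) := by
  funext z
  by_cases hz : z = u.length
  · subst hz
    simp [tapeOf]
  · rw [Function.update_of_ne hz]
    unfold tapeOf
    split_ifs with h
    · rfl
    · have h1 : z.toNat ≠ u.length := by omega
      rcases lt_or_gt_of_ne h1 with h2 | h2
      · rw [List.getElem?_append_left h2, List.getElem?_append_left h2]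
      · rw [List.getElem?_append_right h2.le, List.getElem?_append_right h2.le]
        obtain ⟨k, hk⟩ : ∃ k, z.toNat - u.length = k + 1 := ⟨z.toNat - u.length - 1, by omega⟩
        rw [hk, List.getElem?_cons_succ, List.getElem?_cons_succ]

omit [Finite Out] in
theorem update_tapeOf_length (w : List P.G) (o : Option P.G) :
    Function.update (P.tapeOf w) w.length o = P.tapeOf (w ++ o.toList) := by
  funext z
  by_cases hz : z = w.length
  · subst hz
    cases o <;> simp [tapeOf]
  · rw [Function.update_of_ne hz]
    unfold tapeOf
    split_ifs with h
    · rfl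
    · have h1 : z.toNat ≠ w.length := by omega
      rcases lt_or_gt_of_ne h1 with h2 | h2
      · rw [List.getElem?_append_left h2]
      · cases o with
        | none => simp
        | some g =>
          rw [List.getElem?_eq_none (by omega), List.getElem?_eq_none]
          simp
          omega

end Sweeper

/-- A step of a transducer from a configuration in which all work heads are at a distance of at
most `s` from the origin. -/
def Transducer.BoundedStep {Out : Type} (M : Transducer Out) (x : List Bool) (s : ℕ)
    (c c' : M.Cfg) : Prop :=
  (∀ t, (c.head t).natAbs ≤ s) ∧ M.step x c = some c'

/-- A halting run through configurations that obey a space bound is the whole computation. -/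
theorem Transducer.computes_of_boundedStep {Out : Type} {M : Transducer Out} {x : List Bool}
    {s : ℕ} {c : M.Cfg} (h : Relation.ReflTransGen (M.BoundedStep x s) M.init c)
    (hc : ∀ t, (c.head t).natAbs ≤ s) (hn : M.step x c = none) :
    M.Computes x c.output ∧ M.SpaceBoundedOn x s := by
  refine ⟨⟨c, Relation.ReflTransGen.mono (fun a b hab => hab.2) _ _ h, hn, rfl⟩, fun e he => ?_⟩
  have key : ∀ a, Relation.ReflTransGen (M.BoundedStep x s) a c →
      StateTransition.Reaches (M.step x) a e → ∀ t, (e.head t).natAbs ≤ s := by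
    intro a ha
    induction ha using Relation.ReflTransGen.head_induction_on with
    | refl =>
      intro hr
      rcases Relation.ReflTransGen.cases_head hr with rfl | ⟨d, hd, -⟩
      · exact hc
      · rw [hn] at hd
        cases hd
    | head hab _ ih =>
      intro hr
      rcases Relation.ReflTransGen.cases_head hr with rfl | ⟨d, hd, hde⟩
      · exact hab.1
      · rw [hab.2] at hd
        cases hd
        exact ih hde
  exact key _ h he

namespace Sweeper

variable {Out : Type} (P : Sweeper Out) [Finite Out] (x : List Bool)

theorem step_cfgOf (q : Phase P.S P.C P.Pending) (p : ℕ) (T : ℤ → Option P.G) (z : ℤ)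
    (y : List Out) :
    P.toTransducer.step x (P.cfgOf q p T z y) = (P.delta q (readInput x p) (T z)).map fun a =>
      P.cfgOf a.state (a.inputMove.onInput x.length p) (Function.update T z (a.write 0))
        ((a.workMove 0).onWork z) (y ++ a.output.toList) := by
  have : Unique (Fin P.toTransducer.k) := inferInstanceAs (Unique (Fin 1))
  have h : ∀ t : Fin P.toTransducer.k, t = (0 : Fin 1) := fun t => Subsingleton.elim _ _
  unfold Transducer.step
  refine congrArg₂ Option.map (funext fun a => ?_) rfl
  unfold cfgOf
  congr 1
  · funext t
    rw [h t]
    rfl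
  · funext t
    rw [h t]

theorem boundedStep_cfgOf {s : ℕ} {q q' : Phase P.S P.C P.Pending} {p p' : ℕ}
    {T T' : ℤ → Option P.G} {z z' : ℤ} {y y' : List Out} (hz : z.natAbs ≤ s)
    (h : (P.delta q (readInput x p) (T z)).map (fun a =>
      P.cfgOf a.state (a.inputMove.onInput x.length p) (Function.update T z (a.write 0))
        ((a.workMove 0).onWork z) (y ++ a.output.toList)) = some (P.cfgOf q' p' T' z' y')) :
    P.toTransducer.BoundedStep x s (P.cfgOf q p T z y) (P.cfgOf q' p' T' z' y') :=
  ⟨fun _ => hz, by rw [step_cfgOf, h]⟩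

theorem run_right (s : ℕ) (p : ℕ) (y : List Out) : ∀ (w u : List P.G) (c : P.C),
    u.length + w.length + 1 ≤ s →
    Relation.ReflTransGen (P.toTransducer.BoundedStep x s)
      (P.cfgOf (.right c) p (P.tapeOf (u ++ w)) u.length y)
      (P.cfgOf (.back (P.sweep c w).1) p (P.tapeOf (u ++ (P.sweep c w).2))
        (u.length + w.length - 1) y)
  | [], u, c, h => by
    simp only [List.append_nil, List.length_nil, Nat.add_zero] at h ⊢
    refine .single (P.boundedStep_cfgOf x (by omega) ?_)
    rw [tapeOf_length]
    simp [delta, update_tapeOf_length, sweep, Move.onInput, Move.onWork]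
  | g :: w, u, c, h => by
    simp only [List.length_cons] at h
    have ih := run_right s p y w (u ++ [(P.scan c g).2]) (P.scan c g).1 (by simp; omega)
    refine .head (b := P.cfgOf (.right (P.scan c g).1) p (P.tapeOf (u ++ [(P.scan c g).2] ++ w))
      (u ++ [(P.scan c g).2]).length y) (P.boundedStep_cfgOf x (by omega) ?_) ?_
    · rw [tapeOf_append_cons]
      simp [delta, update_tapeOf, Move.onInput, Move.onWork]
    · convert ih using 2
      · simp [sweep]
      · simp [sweep]
      · simp only [List.length_append, List.length_cons, List.length_nil]
        push_cast
        ring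

theorem run_back (s : ℕ) (p : ℕ) (y : List Out) (w : List P.G) (c : P.C) (hs : w.length + 1 ≤ s) :
    ∀ (k : ℕ), k ≤ w.length → Relation.ReflTransGen (P.toTransducer.BoundedStep x s)
      (P.cfgOf (.back c) p (P.tapeOf w) (k - 1 : ℤ) y)
      (P.cfgOf (.emit c (P.pending c)) p (P.tapeOf w) 0 y)
  | 0, _ => by
    refine .single (P.boundedStep_cfgOf x (by omega) ?_)
    have h1 : P.tapeOf w (((0 : ℕ) : ℤ) - 1) = none := by simp [tapeOf]
    have h2 : Function.update (P.tapeOf w) (((0 : ℕ) : ℤ) - 1) none = P.tapeOf w :=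
      Function.update_eq_self_iff.2 h1.symm
    rw [h1]
    simp only [delta, Option.map_some, Move.onInput, Move.onWork, h2]
    simp
  | k + 1, hk => by
    have h1 : P.tapeOf w (((k + 1 : ℕ) : ℤ) - 1) = some w[k] := by
      simp [tapeOf]
    have h2 : Function.update (P.tapeOf w) (((k + 1 : ℕ) : ℤ) - 1) (some w[k]) = P.tapeOf w :=
      Function.update_eq_self_iff.2 h1.symm
    refine .head (P.boundedStep_cfgOf x (by omega) ?_) (run_back s p y w c hs k (by omega))
    rw [h1]
    simp only [delta, Option.map_some, Move.onInput, Move.onWork, h2]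
    simp

theorem run_emit (s : ℕ) (p : ℕ) (T : ℤ → Option P.G) (c : P.C) :
    ∀ (l : List Out) (hl : l.length ≤ P.bound) (y : List Out),
    Relation.ReflTransGen (P.toTransducer.BoundedStep x s)
      (P.cfgOf (.emit c ⟨l, hl⟩) p T 0 y) (P.cfgOf (.emit c ⟨[], Nat.zero_le _⟩) p T 0 (y ++ l))
  | [], hl, y => by
    rw [List.append_nil]
  | o :: l, hl, y => by
    have ih := run_emit s p T c l ((Nat.le_succ _).trans hl) (y ++ [o])
    rw [List.append_assoc] at ih
    refine .head (P.boundedStep_cfgOf x (by simp) ?_) ih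
    simp [delta, Move.onInput, Move.onWork]

omit [Finite Out] in
theorem length_le_length_sweep : ∀ (w : List P.G) (c : P.C), w.length ≤ (P.sweep c w).2.length
  | [], _ => by simp
  | g :: w, c => by simpa [sweep] using length_le_length_sweep w _

/-- The run of the transducer during a macro step, up to the choice of the next state. -/
theorem run_sweepOf (s : ℕ) (e : P.Cfg) (h1 : e.word.length + 1 ≤ s)
    (h2 : (P.sweepOf x e).2.length + 1 ≤ s) :
    Relation.ReflTransGen (P.toTransducer.BoundedStep x s)
      (P.cfgOf (.idle e.state) e.inputHead (P.tapeOf e.word) 0 e.output)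
      (P.cfgOf (.emit (P.sweepOf x e).1 ⟨[], Nat.zero_le _⟩) e.inputHead
        (P.tapeOf (P.sweepOf x e).2) 0 (e.output ++ (P.finish (P.sweepOf x e).1).2.2)) := by
  refine .head (b := P.cfgOf (.right (P.load e.state (readInput x e.inputHead))) e.inputHead
    (P.tapeOf ([] ++ e.word)) (([] : List P.G).length) e.output)
    (P.boundedStep_cfgOf x (by simp) ?_) ?_
  · simp [delta, Move.onInput, Move.onWork]
  · refine (P.run_right x s e.inputHead e.output e.word [] _ (by simpa using h1)).trans ?_
    refine .trans ?_ ((P.run_back x s e.inputHead e.output (P.sweepOf x e).2 (P.sweepOf x e).1 h2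
      e.word.length (P.length_le_length_sweep _ _)).trans (P.run_emit x s _ _ _ _ _ _))
    rw [sweepOf]
    simpa using Relation.ReflTransGen.refl

omit [Finite Out] in
theorem length_le_of_step {e e' : P.Cfg} (h : P.Step x e e') :
    e'.word = (P.sweepOf x e).2 ∧ e.word.length ≤ e'.word.length := by
  obtain ⟨s, -, rfl⟩ := h
  exact ⟨rfl, P.length_le_length_sweep _ _⟩

theorem run_step (s : ℕ) {e e' : P.Cfg} (h : P.Step x e e') (hs : e'.word.length + 1 ≤ s) :
    Relation.ReflTransGen (P.toTransducer.BoundedStep x s)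
      (P.cfgOf (.idle e.state) e.inputHead (P.tapeOf e.word) 0 e.output)
      (P.cfgOf (.idle e'.state) e'.inputHead (P.tapeOf e'.word) 0 e'.output) := by
  obtain ⟨h1, h2⟩ := P.length_le_of_step x h
  refine (P.run_sweepOf x s e (by omega) (by rw [← h1]; exact hs)).tail
    (P.boundedStep_cfgOf x (by simp) ?_)
  obtain ⟨s', h3, rfl⟩ := h
  simp [delta, h3, Move.onWork]

/-- The transducer computes the output of the macro computation, in the space that the final word
needs. -/
theorem toTransducer_computes (s : ℕ) {e : P.Cfg} {y : List Out}
    (h : Relation.ReflTransGen (P.Step x) P.init e) (hy : P.Halts x e y)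
    (hs : (P.sweepOf x e).2.length + 1 ≤ s) (hs' : e.word.length + 1 ≤ s) :
    P.toTransducer.Computes x y ∧ P.toTransducer.SpaceBoundedOn x s := by
  have key : ∀ a, Relation.ReflTransGen (P.Step x) a e → a.word.length ≤ e.word.length ∧
      Relation.ReflTransGen (P.toTransducer.BoundedStep x s)
        (P.cfgOf (.idle a.state) a.inputHead (P.tapeOf a.word) 0 a.output)
        (P.cfgOf (.idle e.state) e.inputHead (P.tapeOf e.word) 0 e.output) := by
    intro a ha
    induction ha using Relation.ReflTransGen.head_induction_on with
    | refl => exact ⟨le_rfl, .refl⟩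
    | head hab _ ih =>
      exact ⟨(P.length_le_of_step x hab).2.trans ih.1,
        (P.run_step x s hab (by omega)).trans ih.2⟩
  have hinit : P.cfgOf (.idle P.init.state) P.init.inputHead (P.tapeOf P.init.word) 0
      P.init.output = P.toTransducer.init := by
    simp only [cfgOf, Transducer.init]
    congr 1
    funext _ z
    simp [tapeOf, init, toTransducer]
  have hrun := (key _ h).2.trans (P.run_sweepOf x s e hs' hs)
  rw [hinit] at hrun
  have := Transducer.computes_of_boundedStep hrun (fun _ => by simp [cfgOf]) (by
    rw [step_cfgOf]
    simp [delta, hy.1])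
  rw [hy.2]
  exact this

end Sweeper

/-! ### Counters on a word of digits -/

/-- The counters of the machine that writes down the game: the cell and the time of the current row
and of the current column. The counter `zero` is never changed; it is there to compare others
with it. -/
inductive Track
  | rowCell
  | rowTime
  | colCell
  | colTime
  | zero
  deriving DecidableEq

instance : Fintype Track :=
  ⟨{.rowCell, .rowTime, .colCell, .colTime, .zero}, fun t => by cases t <;> simp⟩

/-- The first `ℓ` digits, least significant digit first, of the values of all counters. -/
def cells (b : ℕ) [NeZero b] : ℕ → (Track → ℕ) → List (Track → Fin b)
  | 0, _ => []
  | ℓ + 1, v => (fun i => Fin.ofNat b (v i)) :: cells b ℓ fun i => v i / b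

section Counters

variable {b : ℕ} [NeZero b]

theorem length_cells (ℓ : ℕ) (v : Track → ℕ) : (cells b ℓ v).length = ℓ := by
  induction ℓ generalizing v with
  | zero => rfl
  | succ ℓ ih => simp [cells, ih]

/-- The carry after the addition of a carry to a digit. -/
def carryOver (a : Fin b) (k : Bool) : Bool := decide (b ≤ a.val + k.toNat)

theorem add_carry_div (v : ℕ) (k : Bool) :
    v / b + (carryOver (Fin.ofNat b v) k).toNat = (v + k.toNat) / b := by
  have hb := NeZero.pos b
  have hm := Nat.mod_lt v hb
  have hk : k.toNat ≤ 1 := Bool.toNat_le k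
  have hv := Nat.div_add_mod v b
  unfold carryOver
  rw [Fin.val_ofNat]
  by_cases h : b ≤ v % b + k.toNat
  · rw [decide_eq_true h]
    symm
    apply Nat.div_eq_of_lt_le
    · have : (v / b + true.toNat) * b = b * (v / b) + b := by simp; ring
      omega
    · have : (v / b + true.toNat + 1) * b = b * (v / b) + b + b := by simp; ring
      omega
  · rw [decide_eq_false h]
    symm
    apply Nat.div_eq_of_lt_le
    · have : (v / b + false.toNat) * b = b * (v / b) := by simp; ring
      omega
    · have : (v / b + false.toNat + 1) * b = b * (v / b) + b := by simp; ring
      omega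

omit [NeZero b] in
theorem div_lt_of_lt_pow_succ {v ℓ : ℕ} (h : v < b ^ (ℓ + 1)) : v / b < b ^ ℓ := by
  rw [pow_succ'] at h
  exact Nat.div_lt_of_lt_mul h

theorem pow_le_add_iff (v ℓ : ℕ) (k : Bool) :
    b ^ ℓ ≤ v / b + (carryOver (Fin.ofNat b v) k).toNat ↔ b ^ (ℓ + 1) ≤ v + k.toNat := by
  rw [add_carry_div, Nat.le_div_iff_mul_le (NeZero.pos b), pow_succ]

/-- Overflowing counters start again at `0`. -/
theorem cells_update_pow (ℓ : ℕ) (v : Track → ℕ) (i : Track) :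
    cells b ℓ (Function.update v i (b ^ ℓ)) = cells b ℓ (Function.update v i 0) := by
  induction ℓ generalizing v with
  | zero => rfl
  | succ ℓ ih =>
    have key : ∀ c, (fun j => Function.update v i c j / b) =
        Function.update (fun j => v j / b) i (c / b) := by
      intro c
      funext j
      by_cases h : j = i
      · subst h; simp
      · simp [h]
    simp only [cells, key]
    rw [pow_succ, Nat.mul_div_cancel _ (NeZero.pos b), Nat.zero_div, ih]
    congr 1
    funext j
    by_cases h : j = i
    · subst h
      apply Fin.ext
      simp
    · simp [h]

end Counters

/-- The comparisons of counters that determine the payoffs: the value of the counter `tgt` is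
compared with that of `src`, increased by `1` if `inc` says so. -/
inductive Test
  | sameCell
  | sameTime
  | nextTime
  | rightCell
  | leftCell
  | rowZero
  | colZero
  deriving DecidableEq

instance : Fintype Test :=
  ⟨{.sameCell, .sameTime, .nextTime, .rightCell, .leftCell, .rowZero, .colZero},
    fun t => by cases t <;> simp⟩

namespace Test

/-- The counter from which a comparison starts. -/
def src : Test → Track
  | sameCell => .rowCell
  | sameTime => .rowTime
  | nextTime => .rowTime
  | rightCell => .rowCell
  | leftCell => .colCell
  | rowZero => .zero
  | colZero => .zero

/-- The counter that is compared. -/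
def tgt : Test → Track
  | sameCell => .colCell
  | sameTime => .colTime
  | nextTime => .colTime
  | rightCell => .colCell
  | leftCell => .rowCell
  | rowZero => .rowCell
  | colZero => .colCell

/-- Whether `1` is added before the comparison. -/
def inc : Test → Bool
  | nextTime => true
  | rightCell => true
  | leftCell => true
  | _ => false

end Test

/-- The intermediate results of the comparisons: whether all digits agreed so far, and the carry. -/
abbrev TestState := Test → Bool × Bool

/-- The comparison of one more digit. -/
def TestState.scan {b : ℕ} [NeZero b] (t : TestState) (g : Track → Fin b) : TestState := fun T =>
  ((t T).1 && decide ((g T.tgt).val = (g (T.src) + if (t T).2 then 1 else 0).val),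
    carryOver (g T.src) (t T).2)

/-- The intermediate results before the first digit. -/
def TestState.init : TestState := fun T => (true, T.inc)

/-- The correct results of the comparisons for counters with values below `N`. -/
def TestState.result (N : ℕ) (v : Track → ℕ) : TestState := fun T =>
  (decide (v T.tgt = (v T.src + T.inc.toNat) % N), decide (N ≤ v T.src + T.inc.toNat))

theorem ofNat_add_carry {b : ℕ} [NeZero b] (v : ℕ) (k : Bool) :
    Fin.ofNat b v + (if k then 1 else 0) = Fin.ofNat b (v + k.toNat) := by
  apply Fin.ext
  cases k <;> simp [Fin.val_add]

theorem foldl_scan {b : ℕ} [NeZero b] : ∀ (ℓ : ℕ) (v : Track → ℕ) (t : TestState),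
    (∀ i, v i < b ^ ℓ) → (cells b ℓ v).foldl TestState.scan t = fun T =>
      ((t T).1 && decide (v T.tgt = (v T.src + (t T).2.toNat) % b ^ ℓ),
        decide (b ^ ℓ ≤ v T.src + (t T).2.toNat))
  | 0, v, t, h => by
    funext T
    have h1 : v T.tgt = 0 := by simpa using h T.tgt
    have h2 : v T.src = 0 := by simpa using h T.src
    rcases hT : t T with ⟨_ | _, _ | _⟩ <;> simp [cells, h1, h2, hT, Nat.mod_one]
  | ℓ + 1, v, t, h => by
    rw [cells, List.foldl_cons, foldl_scan ℓ _ _ fun i => div_lt_of_lt_pow_succ (h i)]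
    funext T
    refine Prod.ext ?_ (decide_eq_decide.2 (pow_le_add_iff _ _ _))
    simp only [TestState.scan, add_carry_div, ofNat_add_carry, Fin.val_ofNat]
    rw [Bool.and_assoc]
    congr 1
    rw [← Bool.decide_and]
    apply decide_eq_decide.2
    rw [pow_succ', Nat.mod_mul]
    constructor
    · rintro ⟨h1, h2⟩
      rw [← h1, ← h2, Nat.mod_add_div]
    · intro h1
      rw [h1]
      have hb := NeZero.pos b
      constructor
      · simp
      · rw [Nat.add_mul_div_left _ _ hb, Nat.div_eq_of_lt (Nat.mod_lt _ hb), Nat.zero_add]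

theorem foldl_scan_init {b : ℕ} [NeZero b] (ℓ : ℕ) (v : Track → ℕ) (h : ∀ i, v i < b ^ ℓ) :
    (cells b ℓ v).foldl TestState.scan TestState.init = TestState.result (b ^ ℓ) v := by
  rw [foldl_scan ℓ v _ h]
  funext T
  exact Prod.ext (Bool.true_and _) rfl

/-! ### Payoffs from comparisons of counters -/

namespace RingMachine

variable (R : RingMachine) (x : List Bool)

/-- The comparison of cells that detects the neighbour in a given direction. -/
def _root_.IterElim.Move.test : Move → Test
  | .left => .leftCell
  | .stay => .sameCell
  | .right => .rightCell

open Classical in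
/-- The payoff in a row and a column, given by their tags, the input symbol that belongs to the
cell of the row, and the comparisons between the cells and the times of the row and the column. -/
noncomputable def entry (a : InputSym) (t : TestState) : R.RowTag → R.ColTag → ℤ
  | .var σ, .var σ' =>
      if (t .sameCell).1 = true ∧ (t .sameTime).1 = true ∧ σ' = σ then -1 else 1
  | .var σ, .head σ' =>
      if (t .sameCell).1 = true ∧ (t .sameTime).1 = true ∧ σ' = σ then 1 else 0
  | .var _, .clause _ => 0
  | .var _, .anchor _ => 0
  | .clause (α, β), .var σ' =>
      if (t .nextTime).2 = false ∧ (t .nextTime).1 = true ∧ ((t .colZero).1 = true ∧ σ' = α ∨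
        (t (R.move α).test).1 = true ∧ σ' = β) then 0 else 1
  | .clause (α, β), .head σ' =>
      if (t .sameCell).1 = true ∧ (t .sameTime).1 = true ∧ σ' =
        (if (t .nextTime).2 = true then R.start a else R.next α β (t .rowZero).1) then 1 else 0
  | .clause d, .clause d' =>
      if (t .sameCell).1 = true ∧ (t .sameTime).1 = true ∧ d' = d then 1 else 0
  | .clause _, .anchor _ => 0
  | .anchor _, .var _ => 1
  | .anchor s, .head _ => if s then 0 else -1
  | .anchor s, .clause _ => if s then -1 else 0
  | .anchor s, .anchor s' => if s' = s then 1 else -1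

/-- The values of the counters for given cells and times. -/
def counters (q τ q' τ' : ℕ) : Track → ℕ
  | .rowCell => q
  | .rowTime => τ
  | .colCell => q'
  | .colTime => τ'
  | .zero => 0

theorem ite_eq_ite_of_iff {p p' : Prop} {hp : Decidable p} {hp' : Decidable p'} (h : p ↔ p')
    {α : Type*} {u v : α} : ite p u v = ite p' u v :=
  if_congr h rfl rfl

theorem entry_eq_payoff {N : ℕ} [NeZero N] (q τ q' τ' : Fin N) (ρ : R.RowTag) (κ : R.ColTag)
    (a : InputSym) (ha : (∀ s, ρ ≠ .anchor s) → a = readInput x (q + 1)) :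
    R.entry a (TestState.result N (counters q τ q' τ')) ρ κ =
      (R.horn x N).payoff (R.rowAt q τ ρ) (R.colAt q' τ' κ) := by
  have hmod : ∀ p : Fin N, p.val % N = p.val := fun p => Nat.mod_eq_of_lt p.isLt
  have h1 : ∀ p p' : Fin N, p'.val = (p.val + 1) % N ↔ p' = p + 1 := by
    intro p p'
    rw [Fin.ext_iff, Fin.val_add, Fin.val_one', Nat.add_mod_mod]
  have hsc : ((TestState.result N (counters q τ q' τ')) .sameCell).1 = true ↔ q' = q := by
    simp [TestState.result, counters, Test.src, Test.tgt, Test.inc, hmod, Fin.ext_iff]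
  have hst : ((TestState.result N (counters q τ q' τ')) .sameTime).1 = true ↔ τ' = τ := by
    simp [TestState.result, counters, Test.src, Test.tgt, Test.inc, hmod, Fin.ext_iff]
  have hnt : ((TestState.result N (counters q τ q' τ')) .nextTime).1 = true ↔ τ' = τ + 1 := by
    simp [TestState.result, counters, Test.src, Test.tgt, Test.inc, h1]
  have hlt : ((TestState.result N (counters q τ q' τ')) .nextTime).2 = true ↔ τ + 1 = 0 := by
    rw [succ_eq_zero_iff]
    have : N ≤ τ.val + 1 ↔ τ.val = N - 1 := by omega
    exact decide_eq_true_iff.trans this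
  have hlf : ((TestState.result N (counters q τ q' τ')) .nextTime).2 = false ↔ τ + 1 ≠ 0 := by
    rw [← Bool.not_eq_true, hlt]
  have hrc : ((TestState.result N (counters q τ q' τ')) .rightCell).1 = true ↔ q' = q + 1 := by
    simp [TestState.result, counters, Test.src, Test.tgt, Test.inc, h1]
  have hlc : ((TestState.result N (counters q τ q' τ')) .leftCell).1 = true ↔ q' = q - 1 := by
    rw [eq_sub_iff_add_eq, eq_comm (a := q' + 1), ← h1]
    exact decide_eq_true_iff
  have hzero : ∀ p : Fin N, p.val = (0 + false.toNat) % N ↔ p = 0 := by simp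
  have hcz : ((TestState.result N (counters q τ q' τ')) .colZero).1 = true ↔ q' = 0 :=
    decide_eq_true_iff.trans (hzero q')
  have hrz : ((TestState.result N (counters q τ q' τ')) .rowZero).1 = decide (q = 0) :=
    decide_eq_decide.2 (hzero q)
  have hmv : ∀ d : Move, ((TestState.result N (counters q τ q' τ')) d.test).1 = true ↔
      q' = d.onRing q := by
    rintro (_ | _ | _)
    exacts [hlc, hsc, hrc]
  rcases ρ with σ | ⟨α, β⟩ | s
  · rcases κ with σ' | σ' | d | s'
    · exact ite_eq_ite_of_iff (by rw [hsc, hst, Prod.mk.injEq, Prod.mk.injEq])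
    · exact ite_eq_ite_of_iff (by rw [hsc, hst, Prod.mk.injEq, Prod.mk.injEq])
    · rfl
    · rfl
  · rcases κ with σ' | σ' | d | s'
    · exact ite_eq_ite_of_iff (and_congr hlf (and_congr hnt (or_congr (and_congr_left' hcz)
        (and_congr_left' (hmv _)))))
    · have : (if ((TestState.result N (counters q τ q' τ')) .nextTime).2 = true then R.start a
          else R.next α β ((TestState.result N (counters q τ q' τ')) .rowZero).1) =
          if τ + 1 = 0 then R.start (readInput x (q + 1)) else R.next α β (decide (q = 0)) := by
        rw [hrz, ha (fun s h => by cases h)]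
        exact ite_eq_ite_of_iff hlt
      exact ite_eq_ite_of_iff (by rw [hsc, hst, this, horn, Prod.mk.injEq, Prod.mk.injEq])
    · exact ite_eq_ite_of_iff (by rw [hsc, hst]; simp [Prod.ext_iff])
    · rfl
  · rcases κ with σ' | σ' | d | s' <;> rfl

end RingMachine

/-! ### Writing down the game in logarithmic space -/

instance : Finite InputSym := by
  let f : InputSym → Option (Option Bool) := fun a => match a with
    | .leftEnd => none
    | .bit b => some (some b)
    | .rightEnd => some none
  refine Finite.of_injective f ?_
  rintro (_ | _ | _) (_ | _ | _) h <;> simp_all [f]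

instance {V D : Type} [Finite V] [Finite D] : Finite (HornRow V D) := by
  let f : HornRow V D → V ⊕ D ⊕ Bool := fun r => match r with
    | .var v => .inl v
    | .clause d => .inr (.inl d)
    | .anchor s => .inr (.inr s)
  refine Finite.of_injective f ?_
  rintro (_ | _ | _) (_ | _ | _) h <;> simp_all [f]

/-- The states in which the game is written down. The state `row` writes the entries of the row
whose tag is the first element of `l` for the current cell and time of the column, and advances
the latter; `col` advances the cell of the column; and `nextTime`, `nextCell` advance the time and
the cell of the row. The elements of `l` after the first are the tags of the rows to be written
next, and `final` tells whether the machine halts after these rows. -/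
inductive WriteState (T : Type)
  | row (final : Bool) (l : T)
  | col (final : Bool) (l : T)
  | nextTime
  | nextCell

instance {T : Type} [Finite T] : Finite (WriteState T) := by
  let f : WriteState T → (Bool × T ⊕ Bool × T) ⊕ Bool := fun s => match s with
    | .row f l => .inl (.inl (f, l))
    | .col f l => .inl (.inr (f, l))
    | .nextTime => .inr true
    | .nextCell => .inr false
  refine Finite.of_injective f ?_
  rintro (_ | _ | _ | _) (_ | _ | _ | _) h <;> simp_all [f]

/-- The counter that is advanced in a state. -/
def WriteState.track {T : Type} : WriteState T → Track
  | row _ _ => .colTime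
  | col _ _ => .colCell
  | nextTime => .rowTime
  | nextCell => .rowCell

/-- All states of the machine that writes down the game. In the state `count` it counts the symbols
of the input in binary, in order to mark off sufficiently many cells on the work tape; in the state
`rewind` it returns to the start of the input and clears these cells. -/
inductive WriterState (T : Type)
  | count
  | rewind
  | write (s : WriteState T)

instance {T : Type} [Finite T] : Finite (WriterState T) := by
  let f : WriterState T → Bool ⊕ WriteState T := fun s => match s with
    | .count => .inl true
    | .rewind => .inl false
    | .write s => .inr s
  refine Finite.of_injective f ?_
  rintro (_ | _ | _) (_ | _ | _) h <;> simp_all [f]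

/-- What is remembered during a sweep: the state, the input symbol, a carry, and the intermediate
results of the comparisons of counters. -/
structure ScanState (T : Type) where
  ctl : WriterState T
  sym : InputSym
  carry : Bool
  tests : TestState

instance {T : Type} [Finite T] : Finite (ScanState T) := by
  let f : ScanState T → WriterState T × InputSym × Bool × TestState :=
    fun c => (c.ctl, c.sym, c.carry, c.tests)
  refine Finite.of_injective f ?_
  rintro ⟨_, _, _, _⟩ ⟨_, _, _, _⟩ h
  simp_all [f]

/-- The entry `(z, -z)` of a zero-sum game. -/
def encodePayoff (z : ℤ) : List GameSym := encodeEntry (z, -z)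

namespace RingMachine

variable {R : RingMachine} (sigs : List R.Sig) (b : ℕ) [NeZero b]

/-- Lists of tags of rows that are still to be written. -/
abbrev Tags : Type := {l : List R.RowTag // l.length ≤ (rowTags sigs).length + 2}

/-- The tags of all rows that belong to a cell and a time. -/
def cellTags : Tags sigs := ⟨rowTags sigs, Nat.le_add_right _ _⟩

/-- The tags of the rows that do not belong to a cell and a time. -/
def anchorTags : Tags sigs := ⟨[.anchor false, .anchor true], Nat.le_add_left _ _⟩

variable {sigs} in
/-- The result of a sweep in a writing state. If a list of tags is exhausted, the sweep only serves
to move on to the next state. -/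
noncomputable def finishWrite (a : InputSym) (carry : Bool) (t : TestState) :
    WriteState (Tags sigs) → Option (WriteState (Tags sigs)) × Move × List GameSym
  | .row f ⟨ρ :: l, h⟩ => (if carry then some (.col f ⟨ρ :: l, h⟩) else some (.row f ⟨ρ :: l, h⟩),
      .stay, (colTags sigs).flatMap fun κ => encodePayoff (R.entry a t ρ κ))
  | .row true ⟨[], _⟩ => (none, .stay, [])
  | .row false ⟨[], _⟩ => (some .nextTime, .stay, [])
  | .col f ⟨ρ :: l, h⟩ => if carry then
        (some (.row f ⟨l, (Nat.le_succ _).trans h⟩), .stay,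
          ([.anchor false, .anchor true].flatMap fun κ => encodePayoff (R.entry a t ρ κ)) ++
            [GameSym.newline])
      else (some (.row f ⟨ρ :: l, h⟩), .stay, [])
  | .col _ ⟨[], _⟩ => (none, .stay, [])
  | .nextTime => (if carry then some .nextCell else some (.row false (cellTags sigs)), .stay, [])
  | .nextCell => (if carry then some (.row true (anchorTags sigs))
      else some (.row false (cellTags sigs)), .right, [])

variable {sigs} in
/-- Whether a sweep starts with a carry, that is, advances its counter. -/
def startCarry : WriterState (Tags sigs) → InputSym → Bool
  | .count, .bit _ => true
  | .count, _ => false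
  | .rewind, _ => false
  | .write (.row _ ⟨[], _⟩), _ => false
  | .write _, _ => true

/-- The machine that writes down the game of a ring machine, with counters in base `b`. -/
noncomputable def writer [Finite R.Sig] : Sweeper GameSym where
  S := WriterState (Tags sigs)
  C := ScanState (Tags sigs)
  G := Track → Fin b
  finS := by
    have : Finite (Tags sigs) := (List.finite_length_le R.RowTag _).to_subtype
    infer_instance
  finC := by
    have : Finite (Tags sigs) := (List.finite_length_le R.RowTag _).to_subtype
    infer_instance
  finG := inferInstance
  start := .count
  load s a := ⟨s, a, startCarry s a, TestState.init⟩
  scan c g := match c.ctl with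
    | .count => ({ c with carry := c.carry && decide (g .rowCell ≠ 0) }, Function.update g .rowCell
        (if c.carry then if g .rowCell = 0 then 1 else 0 else g .rowCell))
    | .rewind => (c, fun _ => 0)
    | .write s => ({ c with carry := carryOver (g s.track) c.carry, tests := c.tests.scan g },
        Function.update g s.track (g s.track + if c.carry then 1 else 0))
  grow c := match c.ctl, c.sym with
    | .count, .bit _ => if c.carry then some (Function.update 0 .rowCell 1) else none
    | .count, _ => some 0
    | _, _ => none
  finish c := match c.ctl, c.sym with
    | .count, .bit _ => (some .count, .right, [])
    | .count, _ => (some .rewind, .stay, [])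
    | .rewind, .leftEnd => (some (.write (.row false (cellTags sigs))), .right, [GameSym.newline])
    | .rewind, _ => (some .rewind, .left, [])
    | .write s, a => ((finishWrite a c.carry c.tests s).1.map .write,
        (finishWrite a c.carry c.tests s).2)

variable [Finite R.Sig]

/-- The configurations of the machine while it writes down the game. -/
noncomputable def writerCfg (ℓ : ℕ) (s : WriteState (Tags sigs)) (p : ℕ) (v : Track → ℕ)
    (y : List GameSym) : (writer sigs b).Cfg :=
  ⟨.write s, p, cells b ℓ v, y⟩

variable {b}

theorem sweep_write (s : WriteState (Tags sigs)) (a : InputSym) :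
    ∀ (ℓ : ℕ) (v : Track → ℕ) (k : Bool) (t : TestState), v s.track < b ^ ℓ →
    (writer sigs b).sweep (⟨.write s, a, k, t⟩ : ScanState (Tags sigs)) (cells b ℓ v) =
      ((⟨.write s, a, decide (b ^ ℓ ≤ v s.track + k.toNat), (cells b ℓ v).foldl TestState.scan t⟩ :
        ScanState (Tags sigs)), cells b ℓ (Function.update v s.track (v s.track + k.toNat)))
  | 0, v, k, t, h => by
    have h0 : v s.track = 0 := by simpa using h
    cases k <;> simp [cells, Sweeper.sweep, writer, h0]
  | ℓ + 1, v, k, t, h => by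
    have key : (fun i => Function.update v s.track (v s.track + k.toNat) i / b) =
        Function.update (fun i => v i / b) s.track
          (v s.track / b + (carryOver (Fin.ofNat b (v s.track)) k).toNat) := by
      funext i
      by_cases hi : i = s.track
      · subst hi
        simp only [Function.update_self, add_carry_div]
      · simp only [Function.update_of_ne hi]
    have key2 : (fun i => Fin.ofNat b (Function.update v s.track (v s.track + k.toNat) i)) =
        Function.update (fun i => Fin.ofNat b (v i)) s.track
          (Fin.ofNat b (v s.track) + if k then 1 else 0) := by
      funext i
      by_cases hi : i = s.track
      · subst hi
        simp only [Function.update_self, ofNat_add_carry]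
      · simp only [Function.update_of_ne hi]
    have ih := sweep_write s a ℓ (fun i => v i / b) (carryOver (Fin.ofNat b (v s.track)) k)
      (t.scan fun i => Fin.ofNat b (v i)) (div_lt_of_lt_pow_succ h)
    simp only [cells, key, key2, List.foldl_cons]
    have hscan : (writer sigs b).scan (⟨.write s, a, k, t⟩ : ScanState (Tags sigs))
        (fun i => Fin.ofNat b (v i)) = ((⟨.write s, a, carryOver (Fin.ofNat b (v s.track)) k,
          t.scan fun i => Fin.ofNat b (v i)⟩ : ScanState (Tags sigs)), _) := rfl
    refine (Sweeper.sweep_cons_of_scan hscan _).trans ?_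
    rw [ih]
    refine Prod.ext ?_ rfl
    dsimp only
    congr 1
    exact decide_eq_decide.2 (pow_le_add_iff _ _ _)

variable {sigs} (x : List Bool) {ℓ : ℕ}

theorem writer_sweepOf (s : WriteState (Tags sigs)) (p : ℕ) (v : Track → ℕ) (y : List GameSym)
    (hv : ∀ i, v i < b ^ ℓ) :
    (writer sigs b).sweepOf x (writerCfg sigs b ℓ s p v y) =
      ((⟨.write s, readInput x p,
        decide (b ^ ℓ ≤ v s.track + (startCarry (.write s) (readInput x p)).toNat),
        TestState.result (b ^ ℓ) v⟩ : ScanState (Tags sigs)),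
        cells b ℓ (Function.update v s.track
          (v s.track + (startCarry (.write s) (readInput x p)).toNat))) := by
  rw [← foldl_scan_init ℓ v hv]
  exact sweep_write sigs s _ ℓ v _ _ (hv _)

/-- A step of the machine while it writes down the game. -/
theorem writer_step {s s' : WriteState (Tags sigs)} {p : ℕ} {v v' : Track → ℕ}
    {mv : Move} {o : List GameSym} (y : List GameSym) (hv : ∀ i, v i < b ^ ℓ)
    (hf : finishWrite (readInput x p)
      (decide (b ^ ℓ ≤ v s.track + (startCarry (.write s) (readInput x p)).toNat))
      (TestState.result (b ^ ℓ) v) s = (some s', mv, o))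
    (hc : cells b ℓ (Function.update v s.track
      (v s.track + (startCarry (.write s) (readInput x p)).toNat)) = cells b ℓ v') :
    (writer sigs b).Step x (writerCfg sigs b ℓ s p v y)
      (writerCfg sigs b ℓ s' (mv.onInput x.length p) v' (y ++ o)) := by
  refine ⟨.write s', ?_, ?_⟩
  · rw [writer_sweepOf x s p v y hv]
    change (finishWrite _ _ _ s).1.map _ = _
    rw [hf]
    rfl
  · rw [writer_sweepOf x s p v y hv]
    unfold writerCfg
    congr 1
    · change _ = (finishWrite _ _ _ s).2.1.onInput _ _
      rw [hf]
    · exact hc.symm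
    · change _ = y ++ (finishWrite _ _ _ s).2.2
      rw [hf]

end RingMachine

/-- A loop that runs through `Fin N`, with a body that appends `o i` to the output. -/
theorem reflTransGen_loop {α β : Type*} {r : α → α → Prop} {N : ℕ} (c : ℕ → List β → α)
    (d : List β → α) (o : Fin N → List β)
    (hstep : ∀ (i : Fin N) (y : List β), i.val + 1 < N →
      Relation.ReflTransGen r (c i y) (c (i + 1) (y ++ o i)))
    (hlast : ∀ (i : Fin N) (y : List β), i.val + 1 = N →
      Relation.ReflTransGen r (c i y) (d (y ++ o i))) (hN : 0 < N) (y : List β) :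
    Relation.ReflTransGen r (c 0 y) (d (y ++ (List.finRange N).flatMap o)) := by
  have key : ∀ (j k : ℕ) (y : List β), k + (j + 1) = N → Relation.ReflTransGen r (c k y)
      (d (y ++ ((List.finRange N).drop k).flatMap o)) := by
    intro j
    induction j with
    | zero =>
      intro k y hk
      have hk' : k < N := by omega
      rw [List.drop_eq_getElem_cons (by simpa using hk'), List.drop_eq_nil_of_le (by simp; omega)]
      simpa using hlast ⟨k, hk'⟩ y hk
    | succ j ih =>
      intro k y hk
      have hk' : k < N := by omega
      rw [List.drop_eq_getElem_cons (by simpa using hk'), List.flatMap_cons, ← List.append_assoc]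
      refine .trans (hstep ⟨k, hk'⟩ y (by simp; omega)) ?_
      simpa using ih (k + 1) (y ++ o ⟨k, hk'⟩) (by omega)
  simpa using key (N - 1) 0 y (by omega)

namespace RingMachine

section Loops

variable {R : RingMachine} [Finite R.Sig] {sigs : List R.Sig} {b : ℕ} [NeZero b] (x : List Bool)
  {ℓ N : ℕ} [NeZero N]

theorem counters_lt (q τ q' τ' : Fin N) : ∀ i, counters q τ q' τ' i < N := by
  rintro (_ | _ | _ | _ | _) <;> simp [counters, NeZero.pos]

@[simp] theorem update_colTime (q τ q' τ' k : ℕ) :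
    Function.update (counters q τ q' τ') .colTime k = counters q τ q' k := by
  funext i; cases i <;> simp [counters]
@[simp] theorem update_colCell (q τ q' τ' k : ℕ) :
    Function.update (counters q τ q' τ') .colCell k = counters q τ k τ' := by
  funext i; cases i <;> simp [counters]
@[simp] theorem update_rowTime (q τ q' τ' k : ℕ) :
    Function.update (counters q τ q' τ') .rowTime k = counters q k q' τ' := by
  funext i; cases i <;> simp [counters]
@[simp] theorem update_rowCell (q τ q' τ' k : ℕ) :
    Function.update (counters q τ q' τ') .rowCell k = counters k τ q' τ' := by
  funext i; cases i <;> simp [counters]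

omit [NeZero N] in
theorem cells_counters_colTime (hN : N = b ^ ℓ) (q τ q' : ℕ) :
    cells b ℓ (counters q τ q' N) = cells b ℓ (counters q τ q' 0) := by
  simpa [hN] using cells_update_pow ℓ (counters q τ q' 0) .colTime (b := b)
omit [NeZero N] in
theorem cells_counters_colCell (hN : N = b ^ ℓ) (q τ τ' : ℕ) :
    cells b ℓ (counters q τ N τ') = cells b ℓ (counters q τ 0 τ') := by
  simpa [hN] using cells_update_pow ℓ (counters q τ 0 τ') .colCell (b := b)
omit [NeZero N] in
theorem cells_counters_rowTime (hN : N = b ^ ℓ) (q q' τ' : ℕ) :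
    cells b ℓ (counters q N q' τ') = cells b ℓ (counters q 0 q' τ') := by
  simpa [hN] using cells_update_pow ℓ (counters q 0 q' τ') .rowTime (b := b)
omit [NeZero N] in
theorem cells_counters_rowCell (hN : N = b ^ ℓ) (τ q' τ' : ℕ) :
    cells b ℓ (counters N τ q' τ') = cells b ℓ (counters 0 τ q' τ') := by
  simpa [hN] using cells_update_pow ℓ (counters 0 τ q' τ') .rowCell (b := b)

/-- The description of a row of the game. -/
noncomputable def rowText (sigs : List R.Sig) (N : ℕ) [NeZero N]
    (r : HornRow (Fin N × Fin N × R.Sig) (Fin N × Fin N × R.Sig × R.Sig)) : List GameSym :=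
  ((colList sigs N).flatMap fun c => encodePayoff ((R.horn x N).payoff r c)) ++ [GameSym.newline]

/-- The rest of a row is written during the passage through all cells and times of columns. -/
theorem writer_row (hN : N = b ^ ℓ) (q τ : Fin N) (f : Bool) (ρ : R.RowTag) (l : List R.RowTag)
    (h : (ρ :: l).length ≤ (rowTags sigs).length + 2) (p : ℕ)
    (hp : (∀ s, ρ ≠ .anchor s) → readInput x p = readInput x (q + 1)) (y : List GameSym) :
    Relation.ReflTransGen ((writer sigs b).Step x)
      (writerCfg sigs b ℓ (.row f ⟨ρ :: l, h⟩) p (counters q τ 0 0) y)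
      (writerCfg sigs b ℓ (.row f ⟨l, (Nat.le_succ _).trans h⟩) p (counters q τ 0 0)
        (y ++ rowText x sigs N (R.rowAt q τ ρ))) := by
  have hpos := NeZero.pos N
  have hentry : ∀ (q' τ' : Fin N) (κ : R.ColTag), R.entry (readInput x p)
      (TestState.result (b ^ ℓ) (counters q τ q' τ')) ρ κ =
        (R.horn x N).payoff (R.rowAt q τ ρ) (R.colAt q' τ' κ) := by
    intro q' τ' κ
    rw [← hN]
    exact R.entry_eq_payoff x q τ q' τ' ρ κ _ hp
  have hlt : ∀ (q' τ' : Fin N), ∀ i, counters q τ q' τ' i < b ^ ℓ := fun q' τ' => by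
    rw [← hN]
    exact counters_lt q τ q' τ'
  have hz : ((0 : Fin N) : ℕ) = 0 := by simp
  have hcell : ∀ (q' : Fin N) (y : List GameSym), Relation.ReflTransGen ((writer sigs b).Step x)
      (writerCfg sigs b ℓ (.row f ⟨ρ :: l, h⟩) p (counters q τ q' 0) y)
      (writerCfg sigs b ℓ (.col f ⟨ρ :: l, h⟩) p (counters q τ q' 0)
        (y ++ (List.finRange N).flatMap fun τ' => (colTags sigs).flatMap fun κ =>
          encodePayoff ((R.horn x N).payoff (R.rowAt q τ ρ) (R.colAt q' τ' κ)))) := by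
    intro q' y
    refine reflTransGen_loop
      (fun k y => writerCfg sigs b ℓ (.row f ⟨ρ :: l, h⟩) p (counters q τ q' k) y)
      (fun y => writerCfg sigs b ℓ (.col f ⟨ρ :: l, h⟩) p (counters q τ q' 0) y) _ ?_ ?_ hpos y
    · intro τ' y hτ
      refine .single (writer_step x (mv := .stay) y (hlt q' τ') ?_ ?_)
      · have : ¬ b ^ ℓ ≤ τ'.val + 1 := by omega
        simp [finishWrite, startCarry, WriteState.track, counters, this, ← hentry]
      · simp [startCarry, WriteState.track, counters]
    · intro τ' y hτ
      refine .single (writer_step x (mv := .stay) y (hlt q' τ') ?_ ?_)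
      · have : b ^ ℓ ≤ τ'.val + 1 := by omega
        simp [finishWrite, startCarry, WriteState.track, counters, this, ← hentry]
      · simp only [startCarry, WriteState.track, counters, Bool.toNat_true, update_colTime, hτ]
        exact cells_counters_colTime hN _ _ _
  have hloop := reflTransGen_loop (r := (writer sigs b).Step x)
    (fun k y => writerCfg sigs b ℓ (.row f ⟨ρ :: l, h⟩) p (counters q τ k 0) y)
    (fun y => writerCfg sigs b ℓ (.row f ⟨l, (Nat.le_succ _).trans h⟩) p (counters q τ 0 0)
      (y ++ (([.anchor false, .anchor true].flatMap fun κ => encodePayoff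
        ((R.horn x N).payoff (R.rowAt q τ ρ) (R.colAt 0 0 κ))) ++ [GameSym.newline])))
    (fun q' => (List.finRange N).flatMap fun τ' => (colTags sigs).flatMap fun κ =>
          encodePayoff ((R.horn x N).payoff (R.rowAt q τ ρ) (R.colAt q' τ' κ)))
    (by
      intro q' y hq
      refine .tail (hcell q' y) ?_
      have := writer_step x (ℓ := ℓ) (b := b) (s := .col f ⟨ρ :: l, h⟩)
        (s' := .row f ⟨ρ :: l, h⟩) (p := p) (v := counters q τ q' 0)
        (v' := counters q τ (q' + 1) 0) (mv := .stay) (o := [])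
        (y ++ (List.finRange N).flatMap fun τ' => (colTags sigs).flatMap fun κ =>
          encodePayoff ((R.horn x N).payoff (R.rowAt q τ ρ) (R.colAt q' τ' κ)))
        (by simpa [hz] using hlt q' 0)
        (by
          have : ¬ b ^ ℓ ≤ q'.val + 1 := by omega
          simp [finishWrite, startCarry, WriteState.track, counters, this])
        (by simp [startCarry, WriteState.track, counters])
      rwa [List.append_nil] at this)
    (by
      intro q' y hq
      refine .tail (hcell q' y) (writer_step x (mv := .stay) _ (by simpa [hz] using hlt q' 0) ?_ ?_)
      · have : b ^ ℓ ≤ q'.val + 1 := by omega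
        have he : ∀ s, R.entry (readInput x p) (TestState.result (b ^ ℓ) (counters q τ q' 0)) ρ
            (.anchor s) = (R.horn x N).payoff (R.rowAt q τ ρ) (R.colAt 0 0 (.anchor s)) := by
          intro s
          have := hentry q' 0 (.anchor s)
          rw [hz] at this
          exact this
        simp [finishWrite, startCarry, WriteState.track, counters, this, he]
      · simp only [startCarry, WriteState.track, counters, Bool.toNat_true, update_colCell, hq]
        exact cells_counters_colCell hN _ _ _) hpos y
  convert hloop using 2
  simp only [rowText, colList, List.flatMap_append, List.flatMap_assoc, List.flatMap_map,
    List.append_assoc]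
  rfl

theorem writer_rows (hN : N = b ^ ℓ) (q τ : Fin N) (f : Bool) (p : ℕ) :
    ∀ (l : List R.RowTag) (h : l.length ≤ (rowTags sigs).length + 2) (y : List GameSym),
    (∀ ρ ∈ l, (∀ s, ρ ≠ .anchor s) → readInput x p = readInput x (q + 1)) →
    Relation.ReflTransGen ((writer sigs b).Step x)
      (writerCfg sigs b ℓ (.row f ⟨l, h⟩) p (counters q τ 0 0) y)
      (writerCfg sigs b ℓ (.row f ⟨[], Nat.zero_le _⟩) p (counters q τ 0 0)
        (y ++ l.flatMap fun ρ => rowText x sigs N (R.rowAt q τ ρ)))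
  | [], h, y, _ => by
    rw [List.flatMap_nil, List.append_nil]
  | ρ :: l, h, y, hp => by
    rw [List.flatMap_cons, ← List.append_assoc]
    exact (writer_row x hN q τ f ρ l h p (hp ρ (by simp)) y).trans
      (writer_rows hN q τ f p l _ _ fun ρ' h' => hp ρ' (by simp [h']))

/-- The rows of a cell are written during the passage through all times. -/
theorem writer_cell (hN : N = b ^ ℓ) (q : Fin N) (p : ℕ)
    (hp : readInput x p = readInput x (q + 1)) (y : List GameSym) :
    Relation.ReflTransGen ((writer sigs b).Step x)
      (writerCfg sigs b ℓ (.row false (cellTags sigs)) p (counters q 0 0 0) y)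
      (writerCfg sigs b ℓ .nextCell p (counters q 0 0 0) (y ++ (List.finRange N).flatMap fun τ =>
        (rowTags sigs).flatMap fun ρ => rowText x sigs N (R.rowAt q τ ρ))) := by
  have hpos := NeZero.pos N
  have hz : ((0 : Fin N) : ℕ) = 0 := by simp
  have hlt : ∀ τ : Fin N, ∀ i, counters q τ 0 0 i < b ^ ℓ := fun τ i => by
    rw [← hN]
    simpa using counters_lt q τ 0 0 i
  have hrows : ∀ (τ : Fin N) (y : List GameSym), Relation.ReflTransGen ((writer sigs b).Step x)
      (writerCfg sigs b ℓ (.row false (cellTags sigs)) p (counters q τ 0 0) y)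
      (writerCfg sigs b ℓ .nextTime p (counters q τ 0 0)
        (y ++ (rowTags sigs).flatMap fun ρ => rowText x sigs N (R.rowAt q τ ρ))) := by
    intro τ y
    refine .tail (writer_rows x hN q τ false p _ _ y fun _ _ _ => hp) ?_
    have := writer_step x (ℓ := ℓ) (b := b) (s := .row false ⟨[], Nat.zero_le _⟩)
      (s' := .nextTime (T := Tags sigs)) (p := p) (v := counters q τ 0 0)
      (v' := counters q τ 0 0) (mv := .stay) (o := [])
      (y ++ (rowTags sigs).flatMap fun ρ => rowText x sigs N (R.rowAt q τ ρ)) (hlt τ)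
      (by simp [finishWrite]) (by simp [startCarry, WriteState.track, counters])
    rwa [List.append_nil] at this
  refine reflTransGen_loop
    (fun k y => writerCfg sigs b ℓ (.row false (cellTags sigs)) p (counters q k 0 0) y)
    (fun y => writerCfg sigs b ℓ .nextCell p (counters q 0 0 0) y) _ ?_ ?_ hpos y
  · intro τ y hτ
    refine .tail (hrows τ y) ?_
    have := writer_step x (ℓ := ℓ) (b := b) (s := .nextTime)
      (s' := .row false (cellTags sigs)) (p := p) (v := counters q τ 0 0)
      (v' := counters q (τ + 1) 0 0) (mv := .stay) (o := [])
      (y ++ (rowTags sigs).flatMap fun ρ => rowText x sigs N (R.rowAt q τ ρ)) (hlt τ)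
      (by
        have : ¬ b ^ ℓ ≤ τ.val + 1 := by omega
        simp [finishWrite, startCarry, WriteState.track, counters, this])
      (by simp [startCarry, WriteState.track, counters])
    rwa [List.append_nil] at this
  · intro τ y hτ
    refine .tail (hrows τ y) ?_
    have := writer_step x (ℓ := ℓ) (b := b) (s := .nextTime)
      (s' := .nextCell (T := Tags sigs)) (p := p) (v := counters q τ 0 0)
      (v' := counters q 0 0 0) (mv := .stay) (o := [])
      (y ++ (rowTags sigs).flatMap fun ρ => rowText x sigs N (R.rowAt q τ ρ)) (hlt τ)
      (by
        have : b ^ ℓ ≤ τ.val + 1 := by omega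
        simp [finishWrite, startCarry, WriteState.track, counters, this])
      (by
        simp only [startCarry, WriteState.track, counters, Bool.toNat_true, update_rowTime, hτ]
        exact cells_counters_rowTime hN _ _ _)
    rwa [List.append_nil] at this

theorem readInput_min (p : ℕ) : readInput x (min (p + 1) (x.length + 1)) = readInput x (p + 1) := by
  rcases le_total p x.length with h | h
  · rw [min_eq_left (by omega)]
  · rw [min_eq_right (by omega)]
    simp only [readInput]
    rw [List.getElem?_eq_none le_rfl, List.getElem?_eq_none h]

/-- All rows are written, starting at the first symbol of the input. -/
theorem writer_all (hN : N = b ^ ℓ) (y : List GameSym) :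
    ∃ p, Relation.ReflTransGen ((writer sigs b).Step x)
      (writerCfg sigs b ℓ (.row false (cellTags sigs)) 1 (counters 0 0 0 0) y)
      (writerCfg sigs b ℓ (.row true ⟨[], Nat.zero_le _⟩) p (counters 0 0 0 0)
        (y ++ (rowList sigs N).flatMap (rowText x sigs N))) := by
  have hpos := NeZero.pos N
  have hz : ((0 : Fin N) : ℕ) = 0 := by simp
  have hlt : ∀ q : Fin N, ∀ i, counters q 0 0 0 i < b ^ ℓ := fun q i => by
    rw [← hN]
    simpa using counters_lt q 0 0 0 i
  have hloop := reflTransGen_loop (r := (writer sigs b).Step x)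
    (fun k y => writerCfg sigs b ℓ (.row false (cellTags sigs)) (min (k + 1) (x.length + 1))
      (counters k 0 0 0) y)
    (fun y => writerCfg sigs b ℓ (.row true (anchorTags sigs)) (min (N + 1) (x.length + 1))
      (counters 0 0 0 0) y)
    (fun q => (List.finRange N).flatMap fun τ =>
        (rowTags sigs).flatMap fun ρ => rowText x sigs N (R.rowAt q τ ρ))
    (by
      intro q y hq
      refine .tail (writer_cell x hN q _ (readInput_min x q) y) ?_
      have := writer_step x (ℓ := ℓ) (b := b) (s := .nextCell)
        (s' := .row false (cellTags sigs)) (p := min (q.val + 1) (x.length + 1))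
        (v := counters q 0 0 0) (v' := counters (q + 1) 0 0 0) (mv := .right) (o := [])
        (y ++ (List.finRange N).flatMap fun τ =>
          (rowTags sigs).flatMap fun ρ => rowText x sigs N (R.rowAt q τ ρ)) (hlt q)
        (by
          have : ¬ b ^ ℓ ≤ q.val + 1 := by omega
          simp [finishWrite, startCarry, WriteState.track, counters, this])
        (by simp [startCarry, WriteState.track, counters])
      rw [List.append_nil] at this
      convert this using 2
      simp only [Move.onInput]
      omega)
    (by
      intro q y hq
      refine .tail (writer_cell x hN q _ (readInput_min x q) y) ?_
      have := writer_step x (ℓ := ℓ) (b := b) (s := .nextCell)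
        (s' := .row true (anchorTags sigs)) (p := min (q.val + 1) (x.length + 1))
        (v := counters q 0 0 0) (v' := counters 0 0 0 0) (mv := .right) (o := [])
        (y ++ (List.finRange N).flatMap fun τ =>
          (rowTags sigs).flatMap fun ρ => rowText x sigs N (R.rowAt q τ ρ)) (hlt q)
        (by
          have : b ^ ℓ ≤ q.val + 1 := by omega
          simp [finishWrite, startCarry, WriteState.track, counters, this])
        (by
          simp only [startCarry, WriteState.track, counters, Bool.toNat_true, update_rowCell, hq]
          exact cells_counters_rowCell hN _ _ _)
      rw [List.append_nil] at this
      convert this using 2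
      simp only [Move.onInput]
      omega) hpos y
  have hfin := writer_rows (sigs := sigs) x hN 0 0 true (min (N + 1) (x.length + 1))
    [.anchor false, .anchor true] (Nat.le_add_left _ _)
    (y ++ (List.finRange N).flatMap fun q => (List.finRange N).flatMap fun τ =>
        (rowTags sigs).flatMap fun ρ => rowText x sigs N (R.rowAt q τ ρ)) (by
      intro ρ hρ hne
      simp only [List.mem_cons, List.not_mem_nil, or_false] at hρ
      rcases hρ with rfl | rfl
      · exact absurd rfl (hne false)
      · exact absurd rfl (hne true))
  rw [hz] at hfin
  refine ⟨min (N + 1) (x.length + 1), ?_⟩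
  have hstart : min (0 + 1) (x.length + 1) = 1 := by omega
  rw [hstart] at hloop
  convert hloop.trans hfin using 2
  simp only [rowList, List.flatMap_append, List.flatMap_assoc, List.flatMap_map, List.append_assoc]
  rfl

end Loops

end RingMachine

namespace RingMachine

section Preparation

variable {R : RingMachine} [Finite R.Sig] {sigs : List R.Sig} {b : ℕ} [NeZero b] (x : List Bool)

/-- The word that counts the symbols of the input: `ℓ` binary digits of `k`. -/
def marks (b : ℕ) [NeZero b] : ℕ → ℕ → List (Track → Fin b)
  | 0, _ => []
  | ℓ + 1, k => Function.update 0 .rowCell (if k % 2 = 1 then 1 else 0) :: marks b ℓ (k / 2)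

theorem sweep_count (hb : 1 < b) (c : Bool) (t : TestState) : ∀ (ℓ k : ℕ) (cy : Bool), k < 2 ^ ℓ →
    ∃ cy', (writer sigs b).sweep (⟨.count, .bit c, cy, t⟩ : ScanState (Tags sigs)) (marks b ℓ k) =
      ((⟨.count, .bit c, cy', t⟩ : ScanState (Tags sigs)),
        marks b (if k + cy.toNat < 2 ^ ℓ then ℓ else ℓ + 1) (k + cy.toNat))
  | 0, k, cy, h => by
    have h0 : k = 0 := by simpa using h
    subst h0
    cases cy
    · exact ⟨false, rfl⟩
    · exact ⟨true, rfl⟩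
  | ℓ + 1, k, cy, h => by
    have h10 : (1 : Fin b) ≠ 0 := by
      intro e
      have := congrArg Fin.val e
      rw [Fin.val_one', Nat.mod_eq_of_lt hb] at this
      simp at this
    have hk : k / 2 < 2 ^ ℓ := by rw [pow_succ] at h; omega
    obtain ⟨cy', ih⟩ := sweep_count hb c t ℓ (k / 2) (cy && decide (k % 2 = 1)) hk
    have hcarry : (cy && decide ((if k % 2 = 1 then (1 : Fin b) else 0) ≠ 0)) =
        (cy && decide (k % 2 = 1)) := by
      split_ifs with h2 <;> simp [h2, h10]
    have hdiv : k / 2 + (cy && decide (k % 2 = 1)).toNat = (k + cy.toNat) / 2 := by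
      rcases Nat.mod_two_eq_zero_or_one k with h2 | h2 <;> cases cy <;> simp [h2] <;> omega
    have hlt : k / 2 + (cy && decide (k % 2 = 1)).toNat < 2 ^ ℓ ↔ k + cy.toNat < 2 ^ (ℓ + 1) := by
      rw [hdiv, pow_succ]
      omega
    have hdigit : (if cy then if (if k % 2 = 1 then (1 : Fin b) else 0) = 0 then 1 else 0
        else if k % 2 = 1 then (1 : Fin b) else 0) =
        if (k + cy.toNat) % 2 = 1 then 1 else 0 := by
      rcases Nat.mod_two_eq_zero_or_one k with h2 | h2 <;> cases cy <;>
        simp [h2, h10, Nat.add_mod]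
    refine ⟨cy', ?_⟩
    have hscan : (writer sigs b).scan (⟨.count, .bit c, cy, t⟩ : ScanState (Tags sigs))
        (Function.update 0 .rowCell (if k % 2 = 1 then 1 else 0) : Track → Fin b) =
        ((⟨.count, .bit c, cy && decide (k % 2 = 1), t⟩ : ScanState (Tags sigs)),
          (Function.update 0 .rowCell (if (k + cy.toNat) % 2 = 1 then 1 else 0) :
            Track → Fin b)) := by
      rw [← hcarry, ← hdigit]
      simp only [writer, Function.update_self, Function.update_idem]
    refine (Sweeper.sweep_cons_of_scan hscan _).trans ?_
    rw [ih, hdiv]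
    refine Prod.ext rfl ?_
    simp only [hdiv] at hlt
    by_cases hl : (k + cy.toNat) / 2 < 2 ^ ℓ
    · rw [if_pos hl, if_pos (hlt.1 hl), marks]
      rfl
    · rw [if_neg hl, if_neg fun h => hl (hlt.2 h)]
      rfl

theorem sweep_count_end (t : TestState) : ∀ (w : List (Track → Fin b)),
    (writer sigs b).sweep (⟨.count, .rightEnd, false, t⟩ : ScanState (Tags sigs)) w =
      ((⟨.count, .rightEnd, false, t⟩ : ScanState (Tags sigs)), w ++ [0])
  | [] => rfl
  | g :: w => by
    have hscan : (writer sigs b).scan (⟨.count, .rightEnd, false, t⟩ : ScanState (Tags sigs)) g =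
        ((⟨.count, .rightEnd, false, t⟩ : ScanState (Tags sigs)), g) := by
      simp [writer]
    refine (Sweeper.sweep_cons_of_scan hscan _).trans ?_
    rw [sweep_count_end t w]
    rfl

theorem sweep_rewind (a : InputSym) (t : TestState) : ∀ (w : List (Track → Fin b)),
    (writer sigs b).sweep (⟨.rewind, a, false, t⟩ : ScanState (Tags sigs)) w =
      ((⟨.rewind, a, false, t⟩ : ScanState (Tags sigs)), cells b w.length (counters 0 0 0 0))
  | [] => rfl
  | g :: w => by
    have h0 : counters 0 0 0 0 = fun _ => 0 := by
      funext i
      cases i <;> rfl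
    have hscan : (writer sigs b).scan (⟨.rewind, a, false, t⟩ : ScanState (Tags sigs)) g =
        ((⟨.rewind, a, false, t⟩ : ScanState (Tags sigs)), (fun _ => 0 : Track → Fin b)) := rfl
    refine (Sweeper.sweep_cons_of_scan hscan _).trans ?_
    rw [sweep_rewind a t w, List.length_cons, cells, h0]
    simp only [Nat.zero_div]
    rfl

/-- The input is counted. -/
theorem writer_count (hb : 1 < b) : ∀ k, k ≤ x.length →
    Relation.ReflTransGen ((writer sigs b).Step x) (writer sigs b).init
      (⟨.count, k + 1, marks b (Nat.size k) k, []⟩ : (writer sigs b).Cfg)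
  | 0, _ => by
    rw [Nat.size_zero]
    exact .refl
  | k + 1, hk => by
    refine .tail (writer_count hb k (by omega)) ?_
    obtain ⟨c, hc⟩ : ∃ c, readInput x (k + 1) = .bit c :=
      ⟨x[k], by simp [readInput, List.getElem?_eq_getElem (show k < x.length by omega)]⟩
    obtain ⟨cy', h⟩ := sweep_count (sigs := sigs) hb c TestState.init (Nat.size k) k true
      (Nat.lt_size_self k)
    have hs : (writer sigs b).sweepOf x ⟨.count, k + 1, marks b (Nat.size k) k, []⟩ = _ :=
      (congrArg (fun a => (writer sigs b).sweep ((writer sigs b).load .count a)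
        (marks b (Nat.size k) k)) hc).trans h
    refine ⟨.count, by rw [hs]; rfl, ?_⟩
    rw [hs]
    have hsize : (if k + true.toNat < 2 ^ Nat.size k then Nat.size k else Nat.size k + 1) =
        Nat.size (k + 1) := by
      have h1 := Nat.lt_size_self k
      split_ifs with h2
      · exact le_antisymm (Nat.size_le_size (Nat.le_succ k)) (Nat.size_le.2 h2)
      · refine le_antisymm (Nat.lt_size.2 (not_lt.1 h2)) (Nat.size_le.2 ?_)
        rw [pow_succ]
        omega
    rw [hsize]
    change _ = (⟨.count, min (k + 1 + 1) (x.length + 1), _, _⟩ : (writer sigs b).Cfg)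
    rw [min_eq_left (by omega)]
    rfl

/-- The machine returns to the start of the input. -/
theorem writer_rewind : ∀ (p : ℕ) (w : List (Track → Fin b)),
    Relation.ReflTransGen ((writer sigs b).Step x)
      (⟨.rewind, p, w, []⟩ : (writer sigs b).Cfg)
      (writerCfg sigs b w.length (.row false (cellTags sigs)) 1 (counters 0 0 0 0)
        [GameSym.newline])
  | 0, w => by
    have hs : (writer sigs b).sweepOf x ⟨.rewind, 0, w, []⟩ = _ :=
      sweep_rewind (sigs := sigs) .leftEnd TestState.init w
    refine .single ⟨.write (.row false (cellTags sigs)), by rw [hs]; rfl, ?_⟩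
    rw [hs]
    change _ = (⟨_, min (0 + 1) (x.length + 1), _, _⟩ : (writer sigs b).Cfg)
    rw [min_eq_left (by omega)]
    rfl
  | p + 1, w => by
    have hs : (writer sigs b).sweepOf x ⟨.rewind, p + 1, w, []⟩ = _ :=
      sweep_rewind (sigs := sigs) (readInput x (p + 1)) TestState.init w
    have ih := writer_rewind p (cells b w.length (counters 0 0 0 0))
    rw [length_cells] at ih
    have hne : ∀ C, (writer sigs b).finish (⟨.rewind, readInput x (p + 1), false, C⟩ :
        ScanState (Tags sigs)) = ((some .rewind, .left, []) :
          Option (WriterState (Tags sigs)) × Move × List GameSym) := by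
      intro C
      simp only [readInput]
      rcases x[p]? with _ | c <;> rfl
    refine .head ⟨.rewind, by rw [hs, hne]; rfl, ?_⟩ ih
    rw [hs, hne]
    rfl

/-- The number of cells of the work tape on which the game is written down. -/
def width (x : List Bool) : ℕ := Nat.size x.length + 1

/-- The machine writes down the game. -/
theorem writer_computes (hb : 1 < b) :
    ∃ e : (writer sigs b).Cfg, e.word.length = width x ∧
      ((writer sigs b).sweepOf x e).2.length = width x ∧
      Relation.ReflTransGen ((writer sigs b).Step x) (writer sigs b).init e ∧
      (writer sigs b).Halts x e (R.game x sigs (b ^ width x)).encode := by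
  have hlen : ∀ ℓ k, (marks b ℓ k).length = ℓ := by
    intro ℓ
    induction ℓ with
    | zero => exact fun _ => rfl
    | succ ℓ ih => exact fun k => by simp [marks, ih]
  have h1 := writer_count (sigs := sigs) x hb x.length le_rfl
  have hend : readInput x (x.length + 1) = .rightEnd := by simp [readInput]
  have h2 : (writer sigs b).Step x ⟨.count, x.length + 1, marks b (Nat.size x.length) x.length, []⟩
      ⟨.rewind, x.length + 1, marks b (Nat.size x.length) x.length ++ [0], []⟩ := by
    have hs : (writer sigs b).sweepOf x
        ⟨.count, x.length + 1, marks b (Nat.size x.length) x.length, []⟩ = _ :=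
      (congrArg (fun a => (writer sigs b).sweep ((writer sigs b).load .count a)
        (marks b (Nat.size x.length) x.length)) hend).trans (sweep_count_end TestState.init _)
    refine ⟨.rewind, by rw [hs]; rfl, ?_⟩
    rw [hs]
    rfl
  have h3 := writer_rewind (sigs := sigs) x (x.length + 1)
    (marks b (Nat.size x.length) x.length ++ [0])
  have hw : (marks b (Nat.size x.length) x.length ++ [0]).length = width x := by
    simp [hlen, width]
  rw [hw] at h3
  obtain ⟨p, h4⟩ := writer_all (sigs := sigs) (b := b) x (ℓ := width x) (N := b ^ width x) rfl
    [GameSym.newline]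
  have hv : ∀ i, counters 0 0 0 0 i < b ^ width x := by
    have hpos : 0 < b ^ width x := NeZero.pos _
    rintro (_ | _ | _ | _ | _) <;> exact hpos
  have hs := writer_sweepOf x (ℓ := width x) (b := b)
    (.row true ⟨([] : List R.RowTag), Nat.zero_le ((rowTags sigs).length + 2)⟩) p
    (counters 0 0 0 0) ([GameSym.newline] ++ (rowList sigs (b ^ width x)).flatMap
      (rowText x sigs (b ^ width x))) hv
  refine ⟨_, ?_, ?_, ((h1.tail h2).trans h3).trans h4, ?_, ?_⟩
  · exact length_cells _ _
  · rw [hs]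
    exact length_cells _ _
  · rw [hs]
    rfl
  · rw [hs, encode_game]
    exact (List.append_nil _).symm

/-- The game of a ring machine can be written down in logarithmic space. -/
theorem logSpaceComputable_encode_game (R : RingMachine) [Finite R.Sig] (sigs : List R.Sig)
    (hb : 1 < b) :
    LogSpaceComputable fun x => (R.game x sigs (b ^ width x)).encode := by
  refine ⟨(writer sigs b).toTransducer, 3, fun x => ?_⟩
  obtain ⟨e, h1, h2, h3, h4⟩ := writer_computes (sigs := sigs) x hb
  have hsize : Nat.size x.length ≤ Nat.log 2 x.length + 1 :=
    Nat.size_le.2 (Nat.lt_pow_succ_log_self (by norm_num) _)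
  have hspace : width x + 1 ≤ 3 * (Nat.log 2 x.length + 1) := by
    unfold width
    omega
  exact (writer sigs b).toTransducer_computes x _ h3 h4 (by omega) (by omega)

end Preparation

end RingMachine

/-! ### The reduction -/

/-- A ring of `(2 ^ d) ^ ℓ` cells, where `ℓ` exceeds the number of binary digits of `n`, is at
least this long. -/
theorem exists_eval_le_pow (p : Polynomial ℕ) : ∃ d : ℕ, ∀ n : ℕ, p.eval n ≤ (2 * n + 2) ^ d := by
  induction p using Polynomial.induction_on' with
  | add p q hp hq =>
    obtain ⟨d, hd⟩ := hp
    obtain ⟨e, he⟩ := hq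
    refine ⟨max d e + 1, fun n => ?_⟩
    have h1 := (hd n).trans (Nat.pow_le_pow_right (by omega : 0 < 2 * n + 2) (le_max_left d e))
    have h2 := (he n).trans (Nat.pow_le_pow_right (by omega : 0 < 2 * n + 2) (le_max_right d e))
    rw [Polynomial.eval_add, pow_succ]
    nlinarith [Nat.zero_le ((2 * n + 2) ^ max d e)]
  | monomial k a =>
    refine ⟨a + k, fun n => ?_⟩
    rw [Polynomial.eval_monomial, pow_add]
    exact Nat.mul_le_mul (Nat.lt_two_pow_self.le.trans (Nat.pow_le_pow_left (by omega) _))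
      (Nat.pow_le_pow_left (by omega) _)

/-- For every language in P, some zero-sum games with payoffs `-1`, `0`, `1` that can be written
down in logarithmic space have certificates according to which the designated row is removed
precisely for the words of the language. -/
theorem InP.exists_game {L : Set (List Bool)} (hL : InP L) :
    ∃ f : List Bool → GameInstance, LogSpaceComputable (fun x => (f x).encode) ∧
      ∀ x, (f x).AtMostValues 3 ∧ (f x).ZeroSum ∧
        ∃ (S : Set (Fin (f x).n)) (C : Set (Fin (f x).m)) (rr : Fin (f x).n → ℕ)
          (rc : Fin (f x).m → ℕ), Certificate (f x).A S C rr rc ∧ ((f x).i ∉ S ↔ x ∈ L) := by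
  classical
  obtain ⟨Γ, Λ, _, _, _, _, M, sym, acc, time, -, -, hM⟩ := hL
  obtain ⟨d, hd⟩ := exists_eval_le_pow (2 * (Polynomial.X + time + 2))
  -- the polynomial has a value greater than `1`
  have hd0 : d ≠ 0 := by
    rintro rfl
    have := hd 0
    simp at this
    omega
  have : Finite (ringMachine M acc sym).Sig := inferInstanceAs (Finite (Option (Λ × Γ)))
  have : Fintype (ringMachine M acc sym).Sig := Fintype.ofFinite _
  let sigs : List (ringMachine M acc sym).Sig := (ringMachine M acc sym).flag ::
    (Finset.univ.erase (ringMachine M acc sym).flag).toList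
  have hn : sigs.Nodup := List.nodup_cons.2 ⟨by simp, Finset.nodup_toList _⟩
  have hs : ∀ σ, σ ∈ sigs := fun σ => by
    by_cases h : σ = (ringMachine M acc sym).flag <;> simp [sigs, h]
  have hb : 1 < 2 ^ d := Nat.one_lt_two_pow hd0
  refine ⟨fun x => (ringMachine M acc sym).game x sigs ((2 ^ d) ^ RingMachine.width x),
    RingMachine.logSpaceComputable_encode_game _ sigs hb, fun x =>
    ⟨RingMachine.game_atMostValues _ _ _, RingMachine.game_zeroSum _ _ _, ?_⟩⟩
  obtain ⟨S, C, rr, rc, h1, h2⟩ := RingMachine.exists_game_certificate x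
    (N := (2 ^ d) ^ RingMachine.width x) hn hs rfl
  refine ⟨S, C, rr, rc, h1, h2.trans ?_⟩
  obtain ⟨c, ⟨hc⟩, hhalt, hacc⟩ := hM x
  rw [← hacc]
  -- the ring is long enough for the computation
  have hlarge : 2 * (x.length + time.eval x.length + 2) ≤ (2 ^ d) ^ RingMachine.width x := by
    have h3 := hd x.length
    simp only [Polynomial.eval_mul, Polynomial.eval_add, Polynomial.eval_X,
      Polynomial.eval_ofNat] at h3
    refine h3.trans ?_
    rw [← pow_mul, mul_comm d, pow_mul]
    refine Nat.pow_le_pow_left ?_ d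
    have := Nat.lt_size_self x.length
    unfold RingMachine.width
    rw [pow_succ]
    omega
  obtain ⟨H, hH⟩ : ∃ H, (2 ^ d) ^ RingMachine.width x = 2 * H := by
    obtain ⟨k, hk⟩ : ∃ k, d * RingMachine.width x = k + 1 :=
      Nat.exists_eq_succ_of_ne_zero (Nat.mul_ne_zero hd0 (Nat.succ_ne_zero _))
    exact ⟨2 ^ k, by rw [← pow_mul, hk, pow_succ']⟩
  have key : ∀ (N : ℕ) [NeZero N], 2 * (x.length + time.eval x.length + 2) ≤ N → N = 2 * H →
      ((ringMachine M acc sym).content x N (N - 1) 0 = (ringMachine M acc sym).flag ↔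
        c.q ∈ acc) := by
    rintro N _ hN rfl
    exact content_ringMachine_eq_flag M acc hc hhalt (by omega)
  exact key _ hlarge hH

end IterElim

theorem theorem6p5 :
    IterElim.PHard (IterElim.kZWeak 3) ∧
    IterElim.PHard (IterElim.kZDominance 3) ∧
    IterElim.PHard (IterElim.kZSimultaneous 3) := by
  refine ⟨fun L hL => ?_, fun L hL => ?_, fun L hL => ?_⟩ <;>
    obtain ⟨f, hf, h⟩ := hL.exists_game <;>
    refine ⟨fun x => ⟨f x, (h x).1, (h x).2.1⟩, hf, fun x => ?_⟩ <;>
    obtain ⟨-, hz, S, C, rr, rc, hc, hi⟩ := h x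
  · exact hi.symm.trans (hc.removable_iff_weak hz _).symm
  · exact hi.symm.trans (hc.removable_iff_dominance hz _).symm
  · exact hi.symm.trans (hc.removable_iff_simultaneous hz _).symm
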